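/- For a Schwartz function $u\in\mathcal S(\mathbb R^{1+2})=\mathcal S(\mathbb R_t\times\mathbb R_x^2;\mathbb C)$ let $\widehat u(\tau,\xi)$ be its space-time Fourier transform, and put $\langle a\rangle=(1+|a|^2)^{1/2}$. For $1<r\le 2$, with dual exponent $r'$ given by $\frac1r+\frac1{r'}=1$, and $s,b\in\mathbb R$, let $$\|u\|_{H^r_{s,b}}=\big\|\langle\xi\rangle^{s}\,\langle|\tau|-|\xi|\rangle^{b}\,\widehat u(\tau,\xi)\big\|_{L^{r'}_{\tau\xi}(\mathbb R^{1+2})},$$ and let the wave-Sobolev space $H^r_{s,b}$ be the completion of $\mathcal S(\mathbb R^{1+2})$ with respect to this norm. **Lemma.** Let $1<r\le 2$, $\alpha_1,\alpha_2\ge 0$, $b>\frac1r$ and $\alpha_1+\alpha_2\ge\frac1r+b$. Then there is a constant $C>0$, depending only on $r,b,\alpha_1,\alpha_2$, such that $$\|uv\|_{H^r_{0,b}}\le C\,\|u\|_{H^r_{\alpha_1,b}}\,\|v\|_{H^r_{\alpha_2,b}}$$ for all $u,v\in\mathcal S(\mathbb R^{1+2})$; moreover the product $(u,v)\mapsto uv$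 extends to a continuous bilinear map $H^r_{\alpha_1,b}\times H^r_{\alpha_2,b}\to H^r_{0,b}$ that satisfies the same inequality for all $u\in H^r_{\alpha_1,b}$ and $v\in H^r_{\alpha_2,b}$. -/

import Mathlib

open MeasureTheory UniformSpace
open scoped SchwartzMap FourierTransform ENNReal

noncomputable section

/-- Space-time `ℝ^{1+2}` with its Euclidean structure. Coordinate `0` is the time variable `t`
(on the Fourier side `τ`), coordinates `1, 2` are the space variable `x` (on the Fourier side
`ξ`). -/
abbrev Spacetime : Type := EuclideanSpace ℝ (Fin 3)

/-- The length `|ξ|` of the spatial part of `ζ = (τ, ξ)`. -/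
def spatialNorm (ζ : Spacetime) : ℝ := Real.sqrt (ζ 1 ^ 2 + ζ 2 ^ 2)

/-- The Japanese bracket `⟨a⟩ = (1 + a²)^{1/2}`. -/
def bracket (a : ℝ) : ℝ := Real.sqrt (1 + a ^ 2)

/-- The weight `⟨ξ⟩^s ⟨|τ| - |ξ|⟩^b`. -/
def waveWeight (s b : ℝ) (ζ : Spacetime) : ℝ :=
  bracket (spatialNorm ζ) ^ s * bracket (|ζ 0| - spatialNorm ζ) ^ b

/-- The dual exponent `r'` of `r` (so `1 / r + 1 / r' = 1` for `1 ≤ r`). -/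
def dualExp (r : ℝ) : ℝ≥0∞ := ENNReal.conjExponent (ENNReal.ofReal r)

theorem dualExp_eq {r : ℝ} (hr : 1 < r) : dualExp r = ENNReal.ofReal (r / (r - 1)) := by
  have h : 0 < r - 1 := sub_pos.2 hr
  unfold dualExp ENNReal.conjExponent
  rw [← ENNReal.ofReal_one, ← ENNReal.ofReal_sub r zero_le_one, ← ENNReal.ofReal_inv_of_pos h,
    ← ENNReal.ofReal_add zero_le_one (inv_nonneg.2 h.le)]
  congr 1
  field_simp
  ring

/-- Multiplication by `(2π)⁻¹` on space-time. -/
def freqScale : Spacetime ≃L[ℝ] Spacetime :=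
  ContinuousLinearEquiv.smulLeft
    (Units.mk0 ((2 * Real.pi)⁻¹ : ℝ) (inv_ne_zero Real.two_pi_pos.ne'))

/-- The space-time Fourier transform `û(ζ) = ∫ e^{-i ⟨z, ζ⟩} u(z) dz` in angular frequencies, on
Schwartz functions (Mathlib's `𝓕` uses the character `e^{-2πi ⟨z, ζ⟩}`, whence the dilation). -/
def angularFourier : 𝓢(Spacetime, ℂ) →ₗ[ℂ] 𝓢(Spacetime, ℂ) :=
  (SchwartzMap.compCLMOfContinuousLinearEquiv ℂ freqScale).toLinearMap ∘ₗ
    (SchwartzMap.fourierTransformCLM ℂ).toLinearMap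

theorem angularFourier_apply (u : 𝓢(Spacetime, ℂ)) (ζ : Spacetime) :
    angularFourier u ζ = ∫ z, Complex.exp (-(Complex.I * (inner ℝ z ζ : ℝ))) * u z := by
  have h : angularFourier u ζ = 𝓕 (u : Spacetime → ℂ) ((2 * Real.pi)⁻¹ • ζ) := rfl
  rw [h, Real.fourier_eq']
  refine integral_congr_ae (Filter.Eventually.of_forall fun z => ?_)
  simp only [smul_eq_mul, inner_smul_right]
  congr 2
  push_cast
  have : (Real.pi : ℂ) ≠ 0 := by exact_mod_cast Real.pi_ne_zero
  field_simp

/-- The weighted Fourier transform `⟨ξ⟩^s ⟨|τ| - |ξ|⟩^b û(τ, ξ)`. -/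
def weightedFourier (s b : ℝ) (u : 𝓢(Spacetime, ℂ)) (ζ : Spacetime) : ℂ :=
  (waveWeight s b ζ : ℂ) * angularFourier u ζ

/-- The norm `‖u‖_{H^r_{s,b}} = ‖⟨ξ⟩^s ⟨|τ| - |ξ|⟩^b û‖_{L^{r'}}` of a Schwartz function (finite by
`memLp_weightedFourier`). -/
def waveNorm (r s b : ℝ) (u : 𝓢(Spacetime, ℂ)) : ℝ :=
  (eLpNorm (weightedFourier s b u) (dualExp r) volume).toReal

theorem one_le_bracket (a : ℝ) : 1 ≤ bracket a := by
  unfold bracket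
  rw [Real.one_le_sqrt]
  nlinarith [sq_nonneg a]

theorem continuous_bracket : Continuous bracket := by
  unfold bracket; fun_prop

theorem continuous_spatialNorm : Continuous spatialNorm := by
  unfold spatialNorm; fun_prop

theorem continuous_waveWeight (s b : ℝ) : Continuous (waveWeight s b) := by
  have h (a : ℝ) : bracket a ≠ 0 := (zero_lt_one.trans_le (one_le_bracket a)).ne'
  unfold waveWeight
  refine Continuous.mul ?_ ?_
  · exact (continuous_bracket.comp continuous_spatialNorm).rpow_const fun ζ => Or.inl (h _)
  · refine Continuous.rpow_const (continuous_bracket.comp ?_) fun ζ => Or.inl (h _)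
    exact (by fun_prop : Continuous fun ζ : Spacetime => |ζ 0|).sub continuous_spatialNorm

theorem waveWeight_pos (s b : ℝ) (ζ : Spacetime) : 0 < waveWeight s b ζ := by
  have h (a : ℝ) : 0 < bracket a := zero_lt_one.trans_le (one_le_bracket a)
  exact mul_pos (Real.rpow_pos_of_pos (h _) _) (Real.rpow_pos_of_pos (h _) _)

theorem bracket_rpow_le {a m : ℝ} (s : ℝ) (h : a ^ 2 ≤ m) :
    bracket a ^ s ≤ (1 + m) ^ ⌈|s|⌉₊ := by
  have h1 : bracket a ≤ 1 + m := by
    unfold bracket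
    rw [Real.sqrt_le_left (by nlinarith [sq_nonneg a])]
    nlinarith [sq_nonneg a]
  calc bracket a ^ s ≤ bracket a ^ (⌈|s|⌉₊ : ℝ) :=
        Real.rpow_le_rpow_of_exponent_le (one_le_bracket a)
          ((le_abs_self s).trans (Nat.le_ceil _))
    _ = bracket a ^ ⌈|s|⌉₊ := Real.rpow_natCast _ _
    _ ≤ (1 + m) ^ ⌈|s|⌉₊ := by
        gcongr
        exact zero_le_one.trans (one_le_bracket a)

theorem waveWeight_le (s b : ℝ) (ζ : Spacetime) :
    waveWeight s b ζ ≤ (1 + ‖ζ‖ ^ 2) ^ (⌈|s|⌉₊ + ⌈|b|⌉₊) := by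
  have hn : ‖ζ‖ ^ 2 = ζ 0 ^ 2 + (ζ 1 ^ 2 + ζ 2 ^ 2) := by
    rw [EuclideanSpace.norm_sq_eq]
    simp [Fin.sum_univ_three, add_assoc]
  have hs : spatialNorm ζ ^ 2 = ζ 1 ^ 2 + ζ 2 ^ 2 := Real.sq_sqrt (by positivity)
  have hs0 : 0 ≤ spatialNorm ζ := Real.sqrt_nonneg _
  rw [pow_add]
  unfold waveWeight
  refine mul_le_mul (bracket_rpow_le s ?_) (bracket_rpow_le b ?_) ?_ (by positivity)
  · nlinarith [sq_nonneg (ζ 0)]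
  · nlinarith [mul_nonneg (abs_nonneg (ζ 0)) hs0, sq_abs (ζ 0)]
  · exact Real.rpow_nonneg (zero_le_one.trans (one_le_bracket _)) _

theorem memLp_weightedFourier (s b : ℝ) (u : 𝓢(Spacetime, ℂ)) (p : ℝ≥0∞) :
    MemLp (weightedFourier s b u) p volume := by
  have hg : (fun ζ : Spacetime => (1 + ‖ζ‖ ^ 2) ^ (⌈|s|⌉₊ + ⌈|b|⌉₊)).HasTemperateGrowth := by
    fun_prop
  refine MemLp.of_le
    ((SchwartzMap.smulLeftCLM ℂ
      (fun ζ : Spacetime => (1 + ‖ζ‖ ^ 2) ^ (⌈|s|⌉₊ + ⌈|b|⌉₊)) (angularFourier u)).memLp p volume)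
    ?_ (Filter.Eventually.of_forall fun ζ => ?_)
  · exact ((Complex.continuous_ofReal.comp (continuous_waveWeight s b)).mul
      (angularFourier u).continuous).aestronglyMeasurable
  · rw [SchwartzMap.smulLeftCLM_apply_apply hg, norm_smul, weightedFourier, norm_mul,
      Complex.norm_real, Real.norm_of_nonneg (waveWeight_pos s b ζ).le,
      Real.norm_of_nonneg (by positivity)]
    exact mul_le_mul_of_nonneg_right (waveWeight_le s b ζ) (norm_nonneg _)

instance dualExp.one_le (r : ℝ) : Fact (1 ≤ dualExp r) :=
  ⟨by unfold dualExp ENNReal.conjExponent; exact le_self_add⟩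

/-- The map `u ↦ ⟨ξ⟩^s ⟨|τ| - |ξ|⟩^b û` into `L^{r'}`. -/
def weightedFourierLp (r s b : ℝ) :
    𝓢(Spacetime, ℂ) →ₗ[ℂ] Lp ℂ (dualExp r) (volume : Measure Spacetime) where
  toFun u := (memLp_weightedFourier s b u (dualExp r)).toLp (weightedFourier s b u)
  map_add' u v := by
    rw [← MemLp.toLp_add]
    congr 1
    ext ζ
    simp [weightedFourier, mul_add]
  map_smul' c u := by
    rw [RingHom.id_apply, ← MemLp.toLp_const_smul]
    congr 1
    ext ζ
    simp [weightedFourier]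
    ring

theorem angularFourier_injective : Function.Injective angularFourier := by
  intro u v h
  have h1 : 𝓕 u = 𝓕 v := by
    ext ζ
    obtain ⟨z, rfl⟩ := freqScale.surjective ζ
    exact DFunLike.congr_fun h z
  have h2 (w : 𝓢(Spacetime, ℂ)) : 𝓕⁻ (𝓕 w : 𝓢(Spacetime, ℂ)) = w :=
    FourierTransform.fourierInv_fourier_eq w
  rw [← h2 u, h1, h2]

theorem weightedFourierLp_injective (r s b : ℝ) :
    Function.Injective (weightedFourierLp r s b) := by
  intro u v h
  have hc (w : 𝓢(Spacetime, ℂ)) : Continuous (weightedFourier s b w) :=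
    (Complex.continuous_ofReal.comp (continuous_waveWeight s b)).mul (angularFourier w).continuous
  have h1 := ((hc u).ae_eq_iff_eq volume (hc v)).1 ((MemLp.toLp_eq_toLp_iff
    (memLp_weightedFourier s b u (dualExp r)) (memLp_weightedFourier s b v (dualExp r))).1 h)
  refine angularFourier_injective (DFunLike.ext _ _ fun ζ => ?_)
  have h2 : (waveWeight s b ζ : ℂ) ≠ 0 := by exact_mod_cast (waveWeight_pos s b ζ).ne'
  exact mul_left_cancel₀ h2 (congrFun h1 ζ)

/-- The Schwartz space, to be equipped with the norm `‖·‖_{H^r_{s,b}}`. -/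
def WaveSchwartz (_r _s _b : ℝ) : Type := 𝓢(Spacetime, ℂ)

instance WaveSchwartz.addCommGroup (r s b : ℝ) : AddCommGroup (WaveSchwartz r s b) :=
  inferInstanceAs (AddCommGroup 𝓢(Spacetime, ℂ))

instance WaveSchwartz.module (r s b : ℝ) : Module ℂ (WaveSchwartz r s b) :=
  inferInstanceAs (Module ℂ 𝓢(Spacetime, ℂ))

/-- The norm on the Schwartz space pulled back from `L^{r'}`; it is `waveNorm r s b`, see
`WaveSchwartz.norm_eq`. -/
instance WaveSchwartz.normedAddCommGroup (r s b : ℝ) :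
    NormedAddCommGroup (WaveSchwartz r s b) :=
  NormedAddCommGroup.induced (WaveSchwartz r s b)
    (Lp ℂ (dualExp r) (volume : Measure Spacetime))
    (weightedFourierLp r s b : 𝓢(Spacetime, ℂ) →ₗ[ℂ] _) (weightedFourierLp_injective r s b)

instance WaveSchwartz.normedSpace (r s b : ℝ) : NormedSpace ℂ (WaveSchwartz r s b) where
  norm_smul_le c u := by
    change ‖weightedFourierLp r s b (c • (show 𝓢(Spacetime, ℂ) from u))‖ ≤
      ‖c‖ * ‖weightedFourierLp r s b u‖
    rw [map_smul, norm_smul]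

/-- A Schwartz function, regarded in the normed space `WaveSchwartz r s b`. -/
def WaveSchwartz.of (r s b : ℝ) (u : 𝓢(Spacetime, ℂ)) : WaveSchwartz r s b := u

theorem WaveSchwartz.norm_eq (r s b : ℝ) (u : 𝓢(Spacetime, ℂ)) :
    ‖WaveSchwartz.of r s b u‖ = waveNorm r s b u :=
  Lp.norm_toLp _ (memLp_weightedFourier s b u (dualExp r))

/-- The wave-Sobolev space `H^r_{s,b}`: the completion of the Schwartz space with respect to
`‖·‖_{H^r_{s,b}}`. -/
abbrev WaveSobolev (r s b : ℝ) : Type := Completion (WaveSchwartz r s b)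

/-- A Schwartz function as an element of `H^r_{s,b}`. -/
def WaveSobolev.of (r s b : ℝ) (u : 𝓢(Spacetime, ℂ)) : WaveSobolev r s b :=
  (WaveSchwartz.of r s b u : Completion (WaveSchwartz r s b))

theorem WaveSobolev.norm_of (r s b : ℝ) (u : 𝓢(Spacetime, ℂ)) :
    ‖WaveSobolev.of r s b u‖ = waveNorm r s b u :=
  (Completion.norm_coe _).trans (WaveSchwartz.norm_eq r s b u)

/-- The pointwise product of two Schwartz functions. -/
def schwartzMul (u v : 𝓢(Spacetime, ℂ)) : 𝓢(Spacetime, ℂ) :=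
  SchwartzMap.pairing (ContinuousLinearMap.mul ℂ ℂ) u v

theorem schwartzMul_apply (u v : 𝓢(Spacetime, ℂ)) (z : Spacetime) :
    schwartzMul u v z = u z * v z := rfl

end

/-! On the Fourier side the product is a convolution, so the claim is boundedness of a bilinear
integral operator whose kernel K(ζ,η) is the weight at ζ divided by the weights at η and ζ−η. Hölder
in η with exponents r and r', then Tonelli (`lintegral_convolution_kernel_rpow_le`), reduces it to a
bound on ∫ K(ζ,η)^r dη uniform in almost every ζ, which is `lintegral_kernel_le`.

Put β = br > 1, ζ = (τ,ξ), ρ = |ξ| and, with η now spatial, a = |η|, R = |ξ−η|. The hyperbolic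
Leibniz rule `bracket_modulation_le` distributes ⟨|τ|−ρ⟩^β over the two modulations and a defect d,
equal to a+R−ρ for time frequencies of equal sign and to ρ−|a−R| for opposite signs. Integrating in
the time frequency leaves constants plus terms d^β G(τ∓(a±R)) with G integrable. The spatial weights
can be replaced by ⟨a⟩^{-(1+β)} up to the symmetry η ↦ ξ−η; this is integrable on the plane because
1+β > 2, which settles the terms without defect.

For the defect terms (`lintegral_elliptic_le`, `lintegral_hyperbolic_le`), polar coordinates give at
most (d/a)^β G. Since d/a is bounded by a multiple of the radial derivative of the phase a±R, taking
the phase as variable on each ray yields ∫G. For the phase a−R this bound fails when a is large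
compared with ρ; there the angular derivative dominates d, and the remaining radial integral
ρ^{β-1}∫_{2ρ}^∞ a^{-β} da is bounded independently of ρ. -/

/-! ### Changes of variables on the line. -/

/-- Monotonicity without injectivity suffices, since flat stretches have zero derivative; the image
of `s` is then enlarged to ℝ. -/
theorem setLIntegral_deriv_mul_comp_le_of_monotoneOn {s : Set ℝ} (hs : MeasurableSet s)
    {f f' : ℝ → ℝ} (hf' : ∀ x ∈ s, HasDerivWithinAt f (f' x) s x) (hf : MonotoneOn f s)
    (g : ℝ → ℝ≥0∞) : ∫⁻ x in s, ENNReal.ofReal (f' x) * g (f x) ≤ ∫⁻ y, g y := by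
  rw [← lintegral_image_eq_lintegral_deriv_mul_of_monotoneOn hs hf' hf g]
  exact setLIntegral_le_lintegral _ _

theorem setLIntegral_deriv_mul_comp_le_of_antitoneOn {s : Set ℝ} (hs : MeasurableSet s)
    {f f' : ℝ → ℝ} (hf' : ∀ x ∈ s, HasDerivWithinAt f (f' x) s x) (hf : AntitoneOn f s)
    (g : ℝ → ℝ≥0∞) : ∫⁻ x in s, ENNReal.ofReal (-f' x) * g (f x) ≤ ∫⁻ y, g y := by
  rw [← lintegral_image_eq_lintegral_deriv_mul_of_antitoneOn hs hf' hf g]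
  exact setLIntegral_le_lintegral _ _

/-! ### Geometry of the phases a ± R in polar coordinates. -/

/-- The distance between `a e^{iθ}` and `ρ`. -/
noncomputable def polarDist (ρ a θ : ℝ) : ℝ := Real.sqrt (a ^ 2 + ρ ^ 2 - 2 * a * ρ * Real.cos θ)

section polarDist

variable {ρ a θ : ℝ}

theorem polarDist_radicand (ρ a θ : ℝ) : a ^ 2 + ρ ^ 2 - 2 * a * ρ * Real.cos θ =
    (a - ρ * Real.cos θ) ^ 2 + (ρ * Real.sin θ) ^ 2 := by
  linear_combination ρ ^ 2 * (-Real.sin_sq_add_cos_sq θ)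

theorem polarDist_sq (ρ a θ : ℝ) :
    polarDist ρ a θ ^ 2 = a ^ 2 + ρ ^ 2 - 2 * a * ρ * Real.cos θ := by
  rw [polarDist, Real.sq_sqrt]
  rw [polarDist_radicand]; positivity

theorem abs_sub_mul_cos_le_polarDist (ρ a θ : ℝ) :
    |a - ρ * Real.cos θ| ≤ polarDist ρ a θ := by
  rw [polarDist, polarDist_radicand]
  exact Real.abs_le_sqrt (by nlinarith [sq_nonneg (ρ * Real.sin θ)])

theorem polarDist_le (ha : 0 ≤ a) (hρ : 0 ≤ ρ) : polarDist ρ a θ ≤ a + ρ := by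
  rw [polarDist]
  apply Real.sqrt_le_iff.2 ⟨by positivity, ?_⟩
  nlinarith [mul_nonneg (mul_nonneg ha hρ) (by linarith [Real.neg_one_le_cos θ] : 0 ≤ 1 + Real.cos θ)]

theorem abs_sub_le_polarDist (ha : 0 ≤ a) (hρ : 0 ≤ ρ) : |a - ρ| ≤ polarDist ρ a θ := by
  rw [polarDist]
  apply Real.abs_le_sqrt
  nlinarith [mul_nonneg (mul_nonneg ha hρ) (by linarith [Real.cos_le_one θ] : 0 ≤ 1 - Real.cos θ)]

theorem norm_sub_polar (ρ a θ : ℝ) :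
    ‖(ρ : ℂ) - a * (Real.cos θ + Real.sin θ * Complex.I)‖ = polarDist ρ a θ := by
  rw [polarDist, polarDist_radicand, Complex.norm_def, Complex.normSq_apply]
  congr 1
  simp [-Complex.ofReal_cos, -Complex.ofReal_sin]
  linear_combination (a ^ 2 - ρ ^ 2) * (Real.sin_sq_add_cos_sq θ)

theorem hasDerivAt_polarDist_radius (h : 0 < polarDist ρ a θ) :
    HasDerivAt (fun a => polarDist ρ a θ) ((a - ρ * Real.cos θ) / polarDist ρ a θ) a := by
  have h0 : a ^ 2 + ρ ^ 2 - 2 * a * ρ * Real.cos θ ≠ 0 := by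
    rw [← polarDist_sq]; positivity
  have h1 : HasDerivAt (fun a : ℝ => a ^ 2 + ρ ^ 2 - 2 * a * ρ * Real.cos θ)
      (2 * a - 2 * ρ * Real.cos θ) a := by
    have := (((hasDerivAt_id a).pow 2).add_const (ρ ^ 2)).sub
      (((hasDerivAt_id a).const_mul 2).mul_const ρ |>.mul_const (Real.cos θ))
    convert! this using 1
    simp
  convert! h1.sqrt h0 using 1
  rw [← polarDist]
  field_simp

theorem hasDerivAt_polarDist_angle (h : 0 < polarDist ρ a θ) :
    HasDerivAt (fun θ => polarDist ρ a θ) (a * ρ * Real.sin θ / polarDist ρ a θ) θ := by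
  have h0 : a ^ 2 + ρ ^ 2 - 2 * a * ρ * Real.cos θ ≠ 0 := by
    rw [← polarDist_sq]; positivity
  have h1 : HasDerivAt (fun θ : ℝ => a ^ 2 + ρ ^ 2 - 2 * a * ρ * Real.cos θ)
      (2 * a * ρ * Real.sin θ) θ := by
    have := ((Real.hasDerivAt_cos θ).const_mul (2 * a * ρ)).const_sub (a ^ 2 + ρ ^ 2)
    convert! this using 1
    ring
  convert! h1.sqrt h0 using 1
  rw [← polarDist]
  field_simp

theorem polarDist_pos_of_sin_ne_zero (hρ : 0 < ρ) (h : Real.sin θ ≠ 0) (a : ℝ) :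
    0 < polarDist ρ a θ := by
  rw [polarDist, polarDist_radicand]
  have : ρ * Real.sin θ ≠ 0 := mul_ne_zero hρ.ne' h
  positivity

/-- The defect of the elliptic phase `a + R` is controlled by its radial derivative. -/
theorem add_polarDist_sub_le (ha : 0 < a) (hρ : 0 < ρ) (hR : 0 < polarDist ρ a θ) :
    (a + polarDist ρ a θ - ρ) / a ≤ 2 * (1 + (a - ρ * Real.cos θ) / polarDist ρ a θ) := by
  have h1 := polarDist_sq ρ a θ
  have h2 := abs_le.1 (abs_sub_le_polarDist (θ := θ) ha.le hρ.le)
  set R := polarDist ρ a θ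
  have h3 : 2 * (1 + (a - ρ * Real.cos θ) / R) = 2 * (R + (a - ρ * Real.cos θ)) / R := by
    field_simp
  rw [h3, div_le_div_iff₀ ha hR]
  -- The law of cosines gives 2a(R + a − ρ cos θ) = (a+R)² − ρ², which has the defect as a factor.
  nlinarith [mul_nonneg (by linarith : 0 ≤ a + R - ρ) (by positivity : 0 ≤ a + ρ)]

/-- The defect of the hyperbolic phase `a - R` is controlled by its radial derivative, as long as
`a` is not large compared with `ρ`. -/
theorem sub_abs_sub_polarDist_le_radius (ha : 0 < a) (hρ : 0 < ρ) (h : a ≤ 2 * ρ)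
    (hR : 0 < polarDist ρ a θ) :
    (ρ - |a - polarDist ρ a θ|) / a ≤ 6 * (1 - (a - ρ * Real.cos θ) / polarDist ρ a θ) := by
  have h1 := polarDist_sq ρ a θ
  have h2 := abs_le.1 (abs_sub_le_polarDist (θ := θ) ha.le hρ.le)
  have h4 := polarDist_le (θ := θ) ha.le hρ.le
  set R := polarDist ρ a θ
  have h3 : 6 * (1 - (a - ρ * Real.cos θ) / R) = 6 * (R - (a - ρ * Real.cos θ)) / R := by
    field_simp
  rw [h3, div_le_div_iff₀ ha hR]
  have h5 : |a - R| ≤ ρ := abs_le.2 ⟨by linarith, by linarith⟩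
  -- Here 2a(R − a + ρ cos θ) = ρ² − (a−R)², and R ≤ a + ρ ≤ 3ρ accounts for the constant 6 = 2·3.
  nlinarith [mul_nonneg (by linarith : 0 ≤ ρ - |a - R|)
    (by linarith [abs_nonneg (a - R)] : 0 ≤ 3 * (ρ + |a - R|) - R), sq_abs (a - R)]

/-- The defect of the hyperbolic phase `a - R` is controlled by its angular derivative when `a` is
large compared with `ρ`. -/
theorem sub_abs_sub_polarDist_le_angle (hρ : 0 < ρ) (h : 2 * ρ ≤ a) (hR : 0 < polarDist ρ a θ) :
    ρ - |a - polarDist ρ a θ| ≤ 3 * (a * ρ * |Real.sin θ| / polarDist ρ a θ) := by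
  have ha : 0 < a := by linarith
  have h1 := polarDist_sq ρ a θ
  have h2 := abs_le.1 (abs_sub_le_polarDist (θ := θ) ha.le hρ.le)
  have h4 := polarDist_le (θ := θ) ha.le hρ.le
  have h6 := (abs_le.1 (abs_sub_mul_cos_le_polarDist ρ a θ))
  set R := polarDist ρ a θ
  have h5 : |a - R| ≤ ρ := abs_le.2 ⟨by linarith, by linarith⟩
  have hs : Real.sin θ ^ 2 ≤ |Real.sin θ| := by
    rw [← sq_abs]
    nlinarith [abs_nonneg (Real.sin θ), Real.abs_sin_le_one θ]
  -- The second factor is at least a because R ≥ a − ρ ≥ ρ, so the first is at most ρ² sin²θ / a;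
  -- twice a times the first is ρ² − (a−R)².
  have e1 : (R - a + ρ * Real.cos θ) * (R + a - ρ * Real.cos θ) = ρ ^ 2 * Real.sin θ ^ 2 := by
    linear_combination h1 - ρ ^ 2 * Real.sin_sq_add_cos_sq θ
  have hc : ρ * Real.cos θ ≤ ρ := by nlinarith [Real.cos_le_one θ]
  have e2 : a * (R - a + ρ * Real.cos θ) ≤ ρ ^ 2 * Real.sin θ ^ 2 := by
    rw [← e1]
    nlinarith [mul_nonneg (by linarith : 0 ≤ R - a + ρ * Real.cos θ)
      (by linarith : 0 ≤ R - ρ * Real.cos θ)]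
  have e3 : (ρ - |a - R|) * ρ ≤ 2 * (ρ ^ 2 * Real.sin θ ^ 2) := by
    refine le_trans ?_ (mul_le_mul_of_nonneg_left e2 zero_le_two)
    nlinarith [sq_abs (a - R), mul_nonneg (by linarith : 0 ≤ ρ - |a - R|) (abs_nonneg (a - R))]
  have e4 : ρ - |a - R| ≤ 2 * (ρ * |Real.sin θ|) := by
    have : (ρ - |a - R|) * ρ ≤ (2 * (ρ * |Real.sin θ|)) * ρ := by
      nlinarith [mul_le_mul_of_nonneg_left hs (sq_nonneg ρ)]
    exact le_of_mul_le_mul_right this hρ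
  refine e4.trans ?_
  rw [← mul_div_assoc, le_div_iff₀ hR]
  nlinarith [mul_le_mul_of_nonneg_left (by linarith : R ≤ 3 / 2 * a)
    (by positivity : 0 ≤ ρ * |Real.sin θ|)]

end polarDist

/-! ### Planar integrals of the elliptic and hyperbolic phases. -/

theorem le_bracket (a : ℝ) : a ≤ bracket a := by
  unfold bracket
  exact Real.le_sqrt_of_sq_le (by linarith)

/-- The leading a is the polar Jacobian: it uses one power of the decay, and the other β powers make
the defect scale invariant. -/
theorem mul_bracket_rpow_mul_le {a d β : ℝ} (ha : 0 < a) (hd : 0 ≤ d) (hβ : 0 ≤ β) :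
    a * (bracket a ^ (-(1 + β)) * d ^ β) ≤ (d / a) ^ β := by
  have h : bracket a ^ (-(1 + β)) ≤ a ^ (-(1 + β)) :=
    Real.rpow_le_rpow_of_nonpos ha (le_bracket a) (by linarith)
  calc a * (bracket a ^ (-(1 + β)) * d ^ β) ≤ a * (a ^ (-(1 + β)) * d ^ β) := by gcongr
    _ = (d / a) ^ β := by
      rw [Real.div_rpow hd ha.le, neg_add, Real.rpow_add ha, Real.rpow_neg_one,
        Real.rpow_neg ha.le]
      field_simp

/-- Lowers the power of the defect to one, the power a derivative of the phase can absorb. -/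
theorem rpow_le_mul_of_le {x c β : ℝ} (hx : 0 ≤ x) (hxc : x ≤ c) (hβ : 1 ≤ β) :
    x ^ β ≤ c ^ (β - 1) * x := by
  rcases hx.eq_or_lt with rfl | hx'
  · rw [Real.zero_rpow (by linarith)]; simp
  · calc x ^ β = x ^ (β - 1) * x := by
          rw [← Real.rpow_add_one hx'.ne']; simp
      _ ≤ _ := by gcongr

theorem lintegral_complex_polar (f : ℝ → ℝ → ℝ≥0∞) (ρ : ℝ) :
    ∫⁻ η : ℂ, f ‖η‖ ‖(ρ : ℂ) - η‖ =
      ∫⁻ p in Set.Ioi (0 : ℝ) ×ˢ Set.Ioo (-Real.pi) Real.pi,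
        ENNReal.ofReal p.1 * f p.1 (polarDist ρ p.1 p.2) := by
  rw [← Complex.lintegral_comp_polarCoord_symm, polarCoord_target]
  refine setLIntegral_congr_fun (measurableSet_Ioi.prod measurableSet_Ioo) fun p hp => ?_
  have : (0 : ℝ) < p.1 := hp.1
  simp only [Complex.norm_polarCoord_symm, abs_of_pos this, smul_eq_mul]
  rw [Complex.polarCoord_symm_apply, norm_sub_polar]

theorem measurable_polarDist (ρ : ℝ) : Measurable fun p : ℝ × ℝ => polarDist ρ p.1 p.2 := by
  unfold polarDist; fun_prop

theorem measurable_bracket : Measurable bracket := continuous_bracket.measurable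

/-- Elliptic case of the kernel estimate. -/
theorem lintegral_elliptic_le {β ρ : ℝ} (hβ : 1 < β) (hρ : 0 < ρ) {g : ℝ → ℝ≥0∞}
    (hg : Measurable g) :
    ∫⁻ η : ℂ, ENNReal.ofReal (bracket ‖η‖ ^ (-(1 + β)) * (‖η‖ + ‖(ρ : ℂ) - η‖ - ρ) ^ β) *
        g (‖η‖ + ‖(ρ : ℂ) - η‖) ≤
      ENNReal.ofReal (2 ^ β) * ENNReal.ofReal (2 * Real.pi) * ∫⁻ y, g y := by
  rw [lintegral_complex_polar
    (fun a R => ENNReal.ofReal (bracket a ^ (-(1 + β)) * (a + R - ρ) ^ β) * g (a + R)) ρ]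
  have hm := measurable_polarDist ρ
  have hb := measurable_bracket
  rw [Measure.volume_eq_prod, setLIntegral_prod_symm _ (by fun_prop)]
  have key (θ : ℝ) (hs : Real.sin θ ≠ 0) :
      ∫⁻ a in Set.Ioi 0, ENNReal.ofReal a * (ENNReal.ofReal (bracket a ^ (-(1 + β)) *
        (a + polarDist ρ a θ - ρ) ^ β) * g (a + polarDist ρ a θ)) ≤
      ENNReal.ofReal (2 ^ β) * ∫⁻ y, g y := by
    have hR := polarDist_pos_of_sin_ne_zero hρ hs
    have hder (a : ℝ) : HasDerivAt (fun a => a + polarDist ρ a θ)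
        (1 + (a - ρ * Real.cos θ) / polarDist ρ a θ) a :=
      (hasDerivAt_id a).add (hasDerivAt_polarDist_radius (hR a))
    have hmono : Monotone (fun a => a + polarDist ρ a θ) := by
      refine monotone_of_hasDerivAt_nonneg hder fun a => ?_
      have := (abs_le.1 (abs_sub_mul_cos_le_polarDist ρ a θ)).1
      have : -1 ≤ (a - ρ * Real.cos θ) / polarDist ρ a θ := by
        rw [le_div_iff₀ (hR a)]; linarith
      simp only [Pi.zero_apply]
      linarith
    calc _ ≤ ∫⁻ a in Set.Ioi 0, ENNReal.ofReal (2 ^ β) *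
          (ENNReal.ofReal (1 + (a - ρ * Real.cos θ) / polarDist ρ a θ) *
            g (a + polarDist ρ a θ)) := by
          refine setLIntegral_mono' measurableSet_Ioi fun a (ha : 0 < a) => ?_
          rw [← mul_assoc, ← mul_assoc, ← ENNReal.ofReal_mul ha.le,
            ← ENNReal.ofReal_mul (by positivity)]
          refine mul_le_mul' (ENNReal.ofReal_le_ofReal ?_) le_rfl
          have h2 := abs_le.1 (abs_sub_le_polarDist (θ := θ) ha.le hρ.le)
          have h4 := polarDist_le (θ := θ) ha.le hρ.le
          have hD : 0 ≤ a + polarDist ρ a θ - ρ := by linarith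
          refine (mul_bracket_rpow_mul_le ha hD (by linarith)).trans ?_
          refine (rpow_le_mul_of_le (c := 2) (by positivity) ?_ hβ.le).trans ?_
          -- R ≤ a + ρ bounds the defect by 2a.
          · rw [div_le_iff₀ ha]; linarith
          · have := add_polarDist_sub_le ha hρ (hR a)
            calc _ ≤ (2 : ℝ) ^ (β - 1) * (2 * (1 + (a - ρ * Real.cos θ) / polarDist ρ a θ)) := by
                  gcongr
              _ = _ := by
                rw [Real.rpow_sub_one two_ne_zero]; ring
      _ = ENNReal.ofReal (2 ^ β) * ∫⁻ a in Set.Ioi 0,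
          (ENNReal.ofReal (1 + (a - ρ * Real.cos θ) / polarDist ρ a θ) *
            g (a + polarDist ρ a θ)) := lintegral_const_mul' _ _ ENNReal.ofReal_ne_top
      _ ≤ _ := by
          refine mul_le_mul' le_rfl ?_
          exact setLIntegral_deriv_mul_comp_le_of_monotoneOn measurableSet_Ioi
            (fun a _ => (hder a).hasDerivWithinAt) (hmono.monotoneOn _) g
  calc _ ≤ ∫⁻ θ in Set.Ioo (-Real.pi) Real.pi, ENNReal.ofReal (2 ^ β) * ∫⁻ y, g y := by
        refine setLIntegral_mono_ae' measurableSet_Ioo ?_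
        -- On the ray θ = 0 the distance vanishes at a = ρ and the phase is not differentiable; this
        -- direction is null.
        filter_upwards [Measure.ae_ne volume (0 : ℝ)] with θ h0 hθ
        exact key θ fun h => h0 ((Real.sin_eq_zero_iff_of_lt_of_lt hθ.1 hθ.2).1 h)
    _ = _ := by
        rw [setLIntegral_const, Real.volume_Ioo, mul_right_comm]
        congr 3; ring

/-- Near part of the hyperbolic case of the kernel estimate. -/
theorem lintegral_hyperbolic_near_le {β ρ : ℝ} (hβ : 1 < β) (hρ : 0 < ρ) {g : ℝ → ℝ≥0∞}
    (hg : Measurable g) :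
    ∫⁻ p in Set.Ioc (0 : ℝ) (2 * ρ) ×ˢ Set.Ioo (-Real.pi) Real.pi,
      ENNReal.ofReal p.1 * (ENNReal.ofReal (bracket p.1 ^ (-(1 + β)) *
        (ρ - |p.1 - polarDist ρ p.1 p.2|) ^ β) * g (p.1 - polarDist ρ p.1 p.2)) ≤
      ENNReal.ofReal (3 * 2 ^ β) * ENNReal.ofReal (2 * Real.pi) * ∫⁻ y, g y := by
  have hm := measurable_polarDist ρ
  have hb := measurable_bracket
  rw [Measure.volume_eq_prod, setLIntegral_prod_symm _ (by fun_prop)]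
  have key (θ : ℝ) (hs : Real.sin θ ≠ 0) :
      ∫⁻ a in Set.Ioc 0 (2 * ρ), ENNReal.ofReal a * (ENNReal.ofReal (bracket a ^ (-(1 + β)) *
        (ρ - |a - polarDist ρ a θ|) ^ β) * g (a - polarDist ρ a θ)) ≤
      ENNReal.ofReal (3 * 2 ^ β) * ∫⁻ y, g y := by
    have hR := polarDist_pos_of_sin_ne_zero hρ hs
    have hder (a : ℝ) : HasDerivAt (fun a => a - polarDist ρ a θ)
        (1 - (a - ρ * Real.cos θ) / polarDist ρ a θ) a :=
      (hasDerivAt_id a).sub (hasDerivAt_polarDist_radius (hR a))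
    have hmono : Monotone (fun a => a - polarDist ρ a θ) := by
      refine monotone_of_hasDerivAt_nonneg hder fun a => ?_
      have := (abs_le.1 (abs_sub_mul_cos_le_polarDist ρ a θ)).2
      have : (a - ρ * Real.cos θ) / polarDist ρ a θ ≤ 1 := by
        rw [div_le_iff₀ (hR a)]; linarith
      simp only [Pi.zero_apply]
      linarith
    calc _ ≤ ∫⁻ a in Set.Ioc 0 (2 * ρ), ENNReal.ofReal (3 * 2 ^ β) *
          (ENNReal.ofReal (1 - (a - ρ * Real.cos θ) / polarDist ρ a θ) *
            g (a - polarDist ρ a θ)) := by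
          refine setLIntegral_mono' measurableSet_Ioc fun a haρ => ?_
          have ha : 0 < a := haρ.1
          rw [← mul_assoc, ← mul_assoc, ← ENNReal.ofReal_mul ha.le,
            ← ENNReal.ofReal_mul (by positivity)]
          refine mul_le_mul' (ENNReal.ofReal_le_ofReal ?_) le_rfl
          have h2 := abs_le.1 (abs_sub_le_polarDist (θ := θ) ha.le hρ.le)
          have h4 := polarDist_le (θ := θ) ha.le hρ.le
          have hD : 0 ≤ ρ - |a - polarDist ρ a θ| :=
            sub_nonneg.2 (abs_le.2 ⟨by linarith, by linarith⟩)
          refine (mul_bracket_rpow_mul_le ha hD (by linarith)).trans ?_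
          refine (rpow_le_mul_of_le (c := 2) (by positivity) ?_ hβ.le).trans ?_
          · rw [div_le_iff₀ ha]
            linarith [neg_abs_le (a - polarDist ρ a θ), le_abs_self (a - polarDist ρ a θ)]
          · have := sub_abs_sub_polarDist_le_radius ha hρ haρ.2 (hR a)
            calc _ ≤ (2 : ℝ) ^ (β - 1) * (6 * (1 - (a - ρ * Real.cos θ) / polarDist ρ a θ)) := by
                  gcongr
              _ = _ := by
                rw [Real.rpow_sub_one two_ne_zero]; ring
      _ = ENNReal.ofReal (3 * 2 ^ β) * ∫⁻ a in Set.Ioc 0 (2 * ρ),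
          (ENNReal.ofReal (1 - (a - ρ * Real.cos θ) / polarDist ρ a θ) *
            g (a - polarDist ρ a θ)) := lintegral_const_mul' _ _ ENNReal.ofReal_ne_top
      _ ≤ _ := by
          refine mul_le_mul' le_rfl ?_
          exact setLIntegral_deriv_mul_comp_le_of_monotoneOn measurableSet_Ioc
            (fun a _ => (hder a).hasDerivWithinAt) (hmono.monotoneOn _) g
  calc _ ≤ ∫⁻ θ in Set.Ioo (-Real.pi) Real.pi, ENNReal.ofReal (3 * 2 ^ β) * ∫⁻ y, g y := by
        refine setLIntegral_mono_ae' measurableSet_Ioo ?_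
        filter_upwards [Measure.ae_ne volume (0 : ℝ)] with θ h0 hθ
        exact key θ fun h => h0 ((Real.sin_eq_zero_iff_of_lt_of_lt hθ.1 hθ.2).1 h)
    _ = _ := by
        rw [setLIntegral_const, Real.volume_Ioo, mul_right_comm]
        congr 3; ring

/-- The integral is scale invariant, hence bounded uniformly in ρ; convergence at infinity needs β >
1. -/
theorem lintegral_Ioi_mul_rpow_neg_le {β ρ : ℝ} (hβ : 1 < β) (hρ : 0 < ρ) :
    ∫⁻ a in Set.Ioi (2 * ρ), ENNReal.ofReal (ρ ^ (β - 1) * a ^ (-β)) ≤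
      ENNReal.ofReal (1 / (β - 1)) := by
  have h2 : (0 : ℝ) < 2 * ρ := by positivity
  rw [← ofReal_integral_eq_lintegral_ofReal
    ((integrableOn_Ioi_rpow_of_lt (by linarith) h2).const_mul _)
    (ae_restrict_of_forall_mem measurableSet_Ioi fun a (ha : 2 * ρ < a) => by
      have : 0 < a := h2.trans ha
      change 0 ≤ _
      positivity)]
  apply ENNReal.ofReal_le_ofReal
  rw [integral_const_mul, integral_Ioi_rpow_of_lt (by linarith) h2,
    show -(2 * ρ) ^ (-β + 1) / (-β + 1) = (2 * ρ) ^ (-(β - 1)) / (β - 1) by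
      rw [show -β + 1 = -(β - 1) by ring, neg_div_neg_eq],
    ← mul_div_assoc]
  have h1 : 0 < β - 1 := by linarith
  gcongr
  rw [Real.rpow_neg h2.le, ← div_eq_mul_inv, div_le_one (by positivity)]
  gcongr
  linarith

/-- Far part of the hyperbolic case of the kernel estimate. -/
theorem lintegral_hyperbolic_far_le {β ρ : ℝ} (hβ : 1 < β) (hρ : 0 < ρ) {g : ℝ → ℝ≥0∞}
    (hg : Measurable g) :
    ∫⁻ p in Set.Ioi (2 * ρ) ×ˢ Set.Ioo (-Real.pi) Real.pi,
      ENNReal.ofReal p.1 * (ENNReal.ofReal (bracket p.1 ^ (-(1 + β)) *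
        (ρ - |p.1 - polarDist ρ p.1 p.2|) ^ β) * g (p.1 - polarDist ρ p.1 p.2)) ≤
      ENNReal.ofReal (1 / (β - 1)) * 6 * ∫⁻ y, g y := by
  have hm := measurable_polarDist ρ
  have hb := measurable_bracket
  -- The angle is now the inner variable: a is fixed and the phase is inverted in θ.
  rw [Measure.volume_eq_prod, setLIntegral_prod _ (by fun_prop)]
  have key (a : ℝ) (hρa : 2 * ρ < a) :
      ∫⁻ θ in Set.Ioo (-Real.pi) Real.pi,
        ENNReal.ofReal a * (ENNReal.ofReal (bracket a ^ (-(1 + β)) *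
        (ρ - |a - polarDist ρ a θ|) ^ β) * g (a - polarDist ρ a θ)) ≤
      ENNReal.ofReal (ρ ^ (β - 1) * a ^ (-β)) * (6 * ∫⁻ y, g y) := by
    have ha : 0 < a := by linarith
    have hR (θ : ℝ) : 0 < polarDist ρ a θ := by
      have := (abs_le.1 (abs_sub_le_polarDist (θ := θ) ha.le hρ.le)).2
      linarith
    have hder (θ : ℝ) : HasDerivAt (fun θ => a - polarDist ρ a θ)
        (-(a * ρ * Real.sin θ / polarDist ρ a θ)) θ :=
      (hasDerivAt_polarDist_angle (hR θ)).const_sub a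
    have hcont (s : Set ℝ) : ContinuousOn (fun θ => a - polarDist ρ a θ) s :=
      fun θ _ => (hder θ).continuousAt.continuousWithinAt
    have bound (θ : ℝ) : ENNReal.ofReal a * (ENNReal.ofReal (bracket a ^ (-(1 + β)) *
        (ρ - |a - polarDist ρ a θ|) ^ β) * g (a - polarDist ρ a θ)) ≤
        ENNReal.ofReal (ρ ^ (β - 1) * a ^ (-β)) * (3 *
          (ENNReal.ofReal (a * ρ * |Real.sin θ| / polarDist ρ a θ) *
            g (a - polarDist ρ a θ))) := by
      rw [← mul_assoc, ← mul_assoc, ← mul_assoc, ← ENNReal.ofReal_mul ha.le,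
        show (3 : ℝ≥0∞) = ENNReal.ofReal 3 by simp, ← ENNReal.ofReal_mul (by positivity),
        ← ENNReal.ofReal_mul (by positivity)]
      refine mul_le_mul' (ENNReal.ofReal_le_ofReal ?_) le_rfl
      have h2 := abs_le.1 (abs_sub_le_polarDist (θ := θ) ha.le hρ.le)
      have h4 := polarDist_le (θ := θ) ha.le hρ.le
      have hD : 0 ≤ ρ - |a - polarDist ρ a θ| :=
        sub_nonneg.2 (abs_le.2 ⟨by linarith, by linarith⟩)
      refine (mul_bracket_rpow_mul_le ha hD (by linarith)).trans ?_
      rw [Real.div_rpow hD ha.le, div_eq_mul_inv, ← Real.rpow_neg ha.le]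
      calc _ ≤ (ρ ^ (β - 1) * (ρ - |a - polarDist ρ a θ|)) * a ^ (-β) := by
            refine mul_le_mul_of_nonneg_right (rpow_le_mul_of_le hD ?_ hβ.le) (by positivity)
            linarith [abs_nonneg (a - polarDist ρ a θ)]
        _ ≤ (ρ ^ (β - 1) * (3 * (a * ρ * |Real.sin θ| / polarDist ρ a θ))) * a ^ (-β) := by
            gcongr
            exact sub_abs_sub_polarDist_le_angle hρ hρa.le (hR θ)
        _ = _ := by ring
    have neg : ∫⁻ θ in Set.Icc (-Real.pi) 0,
        ENNReal.ofReal (a * ρ * |Real.sin θ| / polarDist ρ a θ) * g (a - polarDist ρ a θ) ≤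
        ∫⁻ y, g y := by
      refine le_of_eq_of_le (setLIntegral_congr_fun measurableSet_Icc fun θ hθ => ?_)
        (setLIntegral_deriv_mul_comp_le_of_monotoneOn measurableSet_Icc
          (fun θ _ => (hder θ).hasDerivWithinAt) ?_ g)
      · rw [abs_of_nonpos (Real.sin_nonpos_of_nonpos_of_neg_pi_le hθ.2 hθ.1)]
        congr 2; ring
      · refine monotoneOn_of_hasDerivWithinAt_nonneg (convex_Icc _ _) (hcont _)
          (fun θ _ => (hder θ).hasDerivWithinAt) fun θ hθ => ?_
        have hθ' := interior_subset hθ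
        have h1 := Real.sin_nonpos_of_nonpos_of_neg_pi_le hθ'.2 hθ'.1
        rw [neg_nonneg]
        exact div_nonpos_of_nonpos_of_nonneg (mul_nonpos_of_nonneg_of_nonpos (by positivity) h1)
          (hR θ).le
    have pos : ∫⁻ θ in Set.Icc 0 Real.pi,
        ENNReal.ofReal (a * ρ * |Real.sin θ| / polarDist ρ a θ) * g (a - polarDist ρ a θ) ≤
        ∫⁻ y, g y := by
      refine le_of_eq_of_le (setLIntegral_congr_fun measurableSet_Icc fun θ hθ => ?_)
        (setLIntegral_deriv_mul_comp_le_of_antitoneOn measurableSet_Icc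
          (fun θ _ => (hder θ).hasDerivWithinAt) ?_ g)
      · rw [abs_of_nonneg (Real.sin_nonneg_of_nonneg_of_le_pi hθ.1 hθ.2), neg_neg]
      · refine antitoneOn_of_hasDerivWithinAt_nonpos (convex_Icc _ _) (hcont _)
          (fun θ _ => (hder θ).hasDerivWithinAt) fun θ hθ => ?_
        have hθ' := interior_subset hθ
        have h1 := Real.sin_nonneg_of_nonneg_of_le_pi hθ'.1 hθ'.2
        have := hR θ
        rw [neg_nonpos]
        positivity
    -- The phase is monotone on each half circle, so each value is counted at most twice, whence 6 =
    -- 3·2.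
    calc _ ≤ ∫⁻ θ in Set.Icc (-Real.pi) 0 ∪ Set.Icc 0 Real.pi,
          ENNReal.ofReal (ρ ^ (β - 1) * a ^ (-β)) * (3 *
          (ENNReal.ofReal (a * ρ * |Real.sin θ| / polarDist ρ a θ) *
            g (a - polarDist ρ a θ))) := by
          refine (lintegral_mono bound).trans (lintegral_mono_set fun θ hθ => ?_)
          rcases le_total θ 0 with h | h
          · exact Or.inl ⟨hθ.1.le, h⟩
          · exact Or.inr ⟨h, hθ.2.le⟩
      _ = ENNReal.ofReal (ρ ^ (β - 1) * a ^ (-β)) * (3 *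
          ∫⁻ θ in Set.Icc (-Real.pi) 0 ∪ Set.Icc 0 Real.pi,
          (ENNReal.ofReal (a * ρ * |Real.sin θ| / polarDist ρ a θ) *
            g (a - polarDist ρ a θ))) := by
          rw [lintegral_const_mul' _ _ ENNReal.ofReal_ne_top, lintegral_const_mul' _ _ (by simp)]
      _ ≤ ENNReal.ofReal (ρ ^ (β - 1) * a ^ (-β)) * (3 * ((∫⁻ y, g y) + ∫⁻ y, g y)) := by
          refine mul_le_mul' le_rfl (mul_le_mul' le_rfl ?_)
          exact (lintegral_union_le _ _ _).trans (add_le_add neg pos)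
      _ = _ := by
          rw [← two_mul, ← mul_assoc 3]
          norm_num
  calc _ ≤ ∫⁻ a in Set.Ioi (2 * ρ), ENNReal.ofReal (ρ ^ (β - 1) * a ^ (-β)) *
        (6 * ∫⁻ y, g y) := setLIntegral_mono' measurableSet_Ioi key
    _ = (∫⁻ a in Set.Ioi (2 * ρ), ENNReal.ofReal (ρ ^ (β - 1) * a ^ (-β))) *
        (6 * ∫⁻ y, g y) := lintegral_mul_const _ (by fun_prop)
    _ ≤ _ := by
        rw [mul_assoc]
        gcongr
        exact lintegral_Ioi_mul_rpow_neg_le hβ hρ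

/-- Hyperbolic case of the kernel estimate. -/
theorem lintegral_hyperbolic_le {β ρ : ℝ} (hβ : 1 < β) (hρ : 0 < ρ) {g : ℝ → ℝ≥0∞}
    (hg : Measurable g) :
    ∫⁻ η : ℂ, ENNReal.ofReal (bracket ‖η‖ ^ (-(1 + β)) * (ρ - |‖η‖ - ‖(ρ : ℂ) - η‖|) ^ β) *
        g (‖η‖ - ‖(ρ : ℂ) - η‖) ≤
      (ENNReal.ofReal (3 * 2 ^ β) * ENNReal.ofReal (2 * Real.pi) +
        ENNReal.ofReal (1 / (β - 1)) * 6) * ∫⁻ y, g y := by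
  rw [lintegral_complex_polar
    (fun a R => ENNReal.ofReal (bracket a ^ (-(1 + β)) * (ρ - |a - R|) ^ β) * g (a - R)) ρ,
    ← Set.Ioc_union_Ioi_eq_Ioi (by positivity : (0 : ℝ) ≤ 2 * ρ), Set.union_prod, add_mul]
  exact (lintegral_union_le _ _ _).trans (add_le_add (lintegral_hyperbolic_near_le hβ hρ hg)
    (lintegral_hyperbolic_far_le hβ hρ hg))

/-! ### The hyperbolic Leibniz rule. -/

theorem bracket_pos (a : ℝ) : 0 < bracket a := zero_lt_one.trans_le (one_le_bracket a)

theorem bracket_neg (a : ℝ) : bracket (-a) = bracket a := by simp [bracket]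

theorem bracket_abs (a : ℝ) : bracket |a| = bracket a := by simp [bracket]

theorem bracket_le_add_of_abs_le {x y d : ℝ} (h : |x| ≤ |y| + d) (hd : 0 ≤ d) :
    bracket x ≤ bracket y + d := by
  have h1 := le_bracket |y|
  rw [bracket_abs] at h1
  have h2 : bracket y ^ 2 = 1 + y ^ 2 := Real.sq_sqrt (by positivity)
  have h3 := abs_nonneg y
  rw [show bracket x = Real.sqrt (1 + x ^ 2) from rfl, Real.sqrt_le_iff]
  refine ⟨by linarith, ?_⟩
  have h4 : x ^ 2 ≤ (|y| + d) ^ 2 := by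
    rw [← sq_abs x]; gcongr
  nlinarith [sq_abs y, mul_le_mul_of_nonneg_right h1 hd]

theorem add_add_rpow_le {x y z β : ℝ} (hx : 0 ≤ x) (hy : 0 ≤ y) (hz : 0 ≤ z) (hβ : 0 ≤ β) :
    (x + y + z) ^ β ≤ 3 ^ β * (x ^ β + y ^ β + z ^ β) := by
  have hxβ : 0 ≤ x ^ β := by positivity
  have hyβ : 0 ≤ y ^ β := by positivity
  have hzβ : 0 ≤ z ^ β := by positivity
  have key (m : ℝ) (hm : 0 ≤ m) (hm' : x + y + z ≤ 3 * m)
      (h : m ^ β ≤ x ^ β + y ^ β + z ^ β) : (x + y + z) ^ β ≤ 3 ^ β * (x ^ β + y ^ β + z ^ β) :=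
    calc (x + y + z) ^ β ≤ (3 * m) ^ β := by gcongr
      _ = 3 ^ β * m ^ β := Real.mul_rpow (by norm_num) hm
      _ ≤ _ := by gcongr
  rcases le_total x y with h | h <;> rcases le_total y z with h' | h' <;>
    rcases le_total x z with h'' | h''
  · exact key z hz (by linarith) (by linarith)
  · exact key z hz (by linarith) (by linarith)
  · exact key y hy (by linarith) (by linarith)
  · exact key y hy (by linarith) (by linarith)
  · exact key z hz (by linarith) (by linarith)
  · exact key x hx (by linarith) (by linarith)
  · exact key x hx (by linarith) (by linarith)
  · exact key x hx (by linarith) (by linarith)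

/-- As A, B ≥ 0, all the decay can be moved onto the smaller bracket; the sum covers both cases. -/
theorem bracket_rpow_mul_bracket_rpow_le {x y A B s : ℝ} (hA : 0 ≤ A) (hB : 0 ≤ B)
    (hs : s ≤ A + B) :
    bracket x ^ (-A) * bracket y ^ (-B) ≤ bracket x ^ (-s) + bracket y ^ (-s) := by
  have hx := one_le_bracket x
  have hy := one_le_bracket y
  have hx0 := bracket_pos x
  have hy0 := bracket_pos y
  rcases le_total (bracket x) (bracket y) with h | h
  · calc bracket x ^ (-A) * bracket y ^ (-B) ≤ bracket x ^ (-A) * bracket x ^ (-B) := by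
          refine mul_le_mul_of_nonneg_left ?_ (by positivity)
          exact Real.rpow_le_rpow_of_nonpos hx0 h (by linarith)
      _ = bracket x ^ (-(A + B)) := by rw [← Real.rpow_add hx0]; ring_nf
      _ ≤ bracket x ^ (-s) := Real.rpow_le_rpow_of_exponent_le hx (by linarith)
      _ ≤ _ := le_add_of_nonneg_right (by positivity)
  · calc bracket x ^ (-A) * bracket y ^ (-B) ≤ bracket y ^ (-A) * bracket y ^ (-B) := by
          refine mul_le_mul_of_nonneg_right ?_ (by positivity)
          exact Real.rpow_le_rpow_of_nonpos hy0 h (by linarith)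
      _ = bracket y ^ (-(A + B)) := by rw [← Real.rpow_add hy0]; ring_nf
      _ ≤ bracket y ^ (-s) := Real.rpow_le_rpow_of_exponent_le hy (by linarith)
      _ ≤ _ := le_add_of_nonneg_left (by positivity)

/-- If `|w| ≤ |w₁| + |w₂| + d`, the weight `⟨w⟩^β` is distributed over the two modulations and the
defect `d`. -/
theorem bracket_rpow_mul_le_of_abs_le {w w₁ w₂ d β : ℝ} (hβ : 0 ≤ β) (hd : 0 ≤ d)
    (h : |w| ≤ |w₁| + |w₂| + d) :
    bracket w ^ β * (bracket w₁ ^ (-β) * bracket w₂ ^ (-β)) ≤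
      3 ^ β * (bracket w₁ ^ (-β) + bracket w₂ ^ (-β) +
        d ^ β * (bracket w₁ ^ (-β) * bracket w₂ ^ (-β))) := by
  have h1 := bracket_pos w₁
  have h2 := bracket_pos w₂
  have h3 : bracket w ≤ bracket w₁ + bracket w₂ + d := by
    have e := le_bracket |w₂|
    rw [bracket_abs] at e
    have := bracket_le_add_of_abs_le (d := |w₂| + d) (h.trans_eq (add_assoc _ _ _)) (by positivity)
    linarith
  have h4 : bracket w ^ β ≤ 3 ^ β * (bracket w₁ ^ β + bracket w₂ ^ β + d ^ β) :=
    (Real.rpow_le_rpow (bracket_pos w).le h3 hβ).trans (add_add_rpow_le h1.le h2.le hd hβ)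
  refine (mul_le_mul_of_nonneg_right h4 (by positivity)).trans_eq ?_
  have e1 : bracket w₁ ^ β * bracket w₁ ^ (-β) = 1 := by
    rw [← Real.rpow_add h1]; simp
  have e2 : bracket w₂ ^ β * bracket w₂ ^ (-β) = 1 := by
    rw [← Real.rpow_add h2]; simp
  linear_combination 3 ^ β * (bracket w₂ ^ (-β) * e1 + bracket w₁ ^ (-β) * e2)

/-- The hyperbolic Leibniz rule: the modulation of a sum of two frequencies is controlled by the
modulations of the summands and the defect of the elliptic or of the hyperbolic phase, according
to the signs of the time frequencies. -/
theorem bracket_modulation_le {τ₁ τ₂ a R ρ β : ℝ} (hβ : 0 ≤ β)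
    (h1 : ρ ≤ a + R) (h2 : |a - R| ≤ ρ) :
    bracket (|τ₁ + τ₂| - ρ) ^ β *
        (bracket (|τ₁| - a) ^ (-β) * bracket (|τ₂| - R) ^ (-β)) ≤
      3 ^ β * (bracket (τ₁ - a) ^ (-β) + bracket (τ₁ + a) ^ (-β) +
        (bracket (τ₂ - R) ^ (-β) + bracket (τ₂ + R) ^ (-β)) +
        (a + R - ρ) ^ β * (bracket (τ₁ - a) ^ (-β) * bracket (τ₂ - R) ^ (-β) +
          bracket (τ₁ + a) ^ (-β) * bracket (τ₂ + R) ^ (-β)) +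
        (ρ - |a - R|) ^ β * (bracket (τ₁ - a) ^ (-β) * bracket (τ₂ + R) ^ (-β) +
          bracket (τ₁ + a) ^ (-β) * bracket (τ₂ - R) ^ (-β))) := by
  have hp : 0 ≤ a + R - ρ := by linarith
  have hm : 0 ≤ ρ - |a - R| := by linarith
  have pos (x : ℝ) : 0 < bracket x ^ (-β) := Real.rpow_pos_of_pos (bracket_pos x) _
  have p1 := pos (τ₁ - a)
  have p2 := pos (τ₁ + a)
  have p3 := pos (τ₂ - R)
  have p4 := pos (τ₂ + R)
  have flip (x y : ℝ) : bracket (-x - y) = bracket (x + y) := by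
    rw [← bracket_neg]; congr 1; ring
  have hpβ : 0 ≤ (a + R - ρ) ^ β := by positivity
  have hmβ : 0 ≤ (ρ - |a - R|) ^ β := by positivity
  have same : 0 ≤ τ₁ * τ₂ → |τ₁ + τ₂| = |τ₁| + |τ₂| := fun h => abs_add_eq_add_abs_iff _ _ |>.2 <| by
    rcases mul_nonneg_iff.1 h with h | h
    · exact Or.inl h
    · exact Or.inr h
  -- |τ₁| + |τ₂| differs from a + R by at most the two modulations, and a + R exceeds ρ by the
  -- defect.
  have e_same (h : |τ₁ + τ₂| = |τ₁| + |τ₂|) :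
      |(|τ₁ + τ₂| - ρ)| ≤ |(|τ₁| - a)| + |(|τ₂| - R)| + (a + R - ρ) := by
    rw [h, abs_le]
    constructor <;> linarith [le_abs_self (|τ₁| - a), le_abs_self (|τ₂| - R),
      neg_abs_le (|τ₁| - a), neg_abs_le (|τ₂| - R)]
  -- The same comparison with |a − R|, which falls short of ρ by the defect.
  have e_diff (h : |τ₁ + τ₂| = |(|τ₁| - |τ₂|)|) :
      |(|τ₁ + τ₂| - ρ)| ≤ |(|τ₁| - a)| + |(|τ₂| - R)| + (ρ - |a - R|) := by
    have h5 : |(|τ₁| - |τ₂|)| ≤ |(|τ₁| - a)| + |(|τ₂| - R)| + |a - R| := by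
      rw [abs_le]
      constructor <;> linarith [le_abs_self (|τ₁| - a), le_abs_self (|τ₂| - R),
        neg_abs_le (|τ₁| - a), neg_abs_le (|τ₂| - R), le_abs_self (a - R), neg_abs_le (a - R)]
    have h6 : |a - R| ≤ |(|τ₁| - a)| + |(|τ₂| - R)| + |(|τ₁| - |τ₂|)| := by
      rw [abs_le]
      constructor <;> linarith [le_abs_self (|τ₁| - a), le_abs_self (|τ₂| - R),
        neg_abs_le (|τ₁| - a), neg_abs_le (|τ₂| - R), le_abs_self (|τ₁| - |τ₂|),
        neg_abs_le (|τ₁| - |τ₂|)]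
    rw [h, abs_le]
    constructor <;> linarith
  rcases le_total 0 τ₁ with t1 | t1 <;> rcases le_total 0 τ₂ with t2 | t2
  · have := bracket_rpow_mul_le_of_abs_le hβ hp (e_same (same (mul_nonneg t1 t2)))
    rw [abs_of_nonneg t1, abs_of_nonneg t2] at this ⊢
    refine this.trans (mul_le_mul_of_nonneg_left ?_ (by positivity))
    nlinarith [mul_nonneg hpβ (mul_pos p2 p4).le, mul_nonneg hmβ (mul_pos p1 p4).le,
      mul_nonneg hmβ (mul_pos p2 p3).le]
  · have := bracket_rpow_mul_le_of_abs_le hβ hm (e_diff (by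
      rw [abs_of_nonneg t1, abs_of_nonpos t2, sub_neg_eq_add]))
    rw [abs_of_nonneg t1, abs_of_nonpos t2, flip] at this ⊢
    refine this.trans (mul_le_mul_of_nonneg_left ?_ (by positivity))
    nlinarith [mul_nonneg hpβ (mul_pos p2 p4).le, mul_nonneg hpβ (mul_pos p1 p3).le,
      mul_nonneg hmβ (mul_pos p2 p3).le]
  · have := bracket_rpow_mul_le_of_abs_le hβ hm (e_diff (by
      rw [abs_of_nonpos t1, abs_of_nonneg t2, ← abs_neg]; congr 1; ring))
    rw [abs_of_nonpos t1, abs_of_nonneg t2, flip] at this ⊢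
    refine this.trans (mul_le_mul_of_nonneg_left ?_ (by positivity))
    nlinarith [mul_nonneg hpβ (mul_pos p2 p4).le, mul_nonneg hpβ (mul_pos p1 p3).le,
      mul_nonneg hmβ (mul_pos p1 p4).le]
  · have := bracket_rpow_mul_le_of_abs_le hβ hp (e_same (same (mul_nonneg_of_nonpos_of_nonpos t1 t2)))
    rw [abs_of_nonpos t1, abs_of_nonpos t2, flip, flip] at this ⊢
    refine this.trans (mul_le_mul_of_nonneg_left ?_ (by positivity))
    nlinarith [mul_nonneg hpβ (mul_pos p1 p3).le, mul_nonneg hmβ (mul_pos p1 p4).le,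
      mul_nonneg hmβ (mul_pos p2 p3).le]

/-! ### Integration in the time frequency. -/

/-- The function `⟨x⟩^{-β}` with values in `[0, ∞]`. -/
noncomputable def bracketDecay (β x : ℝ) : ℝ≥0∞ := ENNReal.ofReal (bracket x ^ (-β))

@[fun_prop]
theorem measurable_bracketDecay (β : ℝ) : Measurable (bracketDecay β) := by
  have := measurable_bracket
  unfold bracketDecay; fun_prop

theorem lintegral_bracket_norm_rpow_lt_top {E : Type*} [NormedAddCommGroup E] [NormedSpace ℝ E]
    [FiniteDimensional ℝ E] [MeasurableSpace E] [BorelSpace E] (μ : Measure E)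
    [μ.IsAddHaarMeasure] {s : ℝ} (hs : (Module.finrank ℝ E : ℝ) < s) :
    ∫⁻ x, bracketDecay s ‖x‖ ∂μ < ∞ := by
  have h := integrable_rpow_neg_one_add_norm_sq (μ := μ) hs
  have e (x : E) : (1 + ‖x‖ ^ 2) ^ (-s / 2) = bracket ‖x‖ ^ (-s) := by
    rw [bracket, Real.sqrt_eq_rpow, ← Real.rpow_mul (by positivity)]
    ring_nf
  simp only [e] at h
  exact h.lintegral_lt_top

theorem lintegral_bracketDecay_lt_top {β : ℝ} (hβ : 1 < β) : ∫⁻ x, bracketDecay β x < ∞ := by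
  have := lintegral_bracket_norm_rpow_lt_top (volume : Measure ℝ) (s := β) (by simpa using hβ)
  simpa only [bracketDecay, Real.norm_eq_abs, bracket_abs] using this

/-- The self-convolution of `⟨x⟩^{-β}`. -/
noncomputable def bracketConv (β y : ℝ) : ℝ≥0∞ := ∫⁻ x, bracketDecay β x * bracketDecay β (y - x)

@[fun_prop]
theorem measurable_bracketConv (β : ℝ) : Measurable (bracketConv β) :=
  Measurable.lintegral_prod_right' (f := fun p : ℝ × ℝ => bracketDecay β p.2 *
    bracketDecay β (p.1 - p.2)) (by fun_prop)

theorem lintegral_bracketConv (β : ℝ) :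
    ∫⁻ y, bracketConv β y = (∫⁻ x, bracketDecay β x) ^ 2 := by
  unfold bracketConv
  rw [lintegral_lintegral_swap (by fun_prop)]
  have e (x : ℝ) : ∫⁻ y, bracketDecay β x * bracketDecay β (y - x) =
      bracketDecay β x * ∫⁻ y, bracketDecay β y := by
    rw [lintegral_const_mul _ (by fun_prop), lintegral_sub_right_eq_self (bracketDecay β)]
  simp_rw [e]
  rw [lintegral_mul_const _ (by fun_prop), sq]

/-- With p = ±a and q = ±R, the four sign choices produce the phases ±(a+R) and ±(a−R). -/
theorem lintegral_bracketDecay_mul_shift (β τ p q : ℝ) :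
    ∫⁻ t, bracketDecay β (t - p) * bracketDecay β (τ - t - q) = bracketConv β (τ - (p + q)) := by
  rw [bracketConv, ← lintegral_sub_right_eq_self
    (fun x => bracketDecay β x * bracketDecay β (τ - (p + q) - x)) p]
  refine lintegral_congr fun t => ?_
  congr 2
  ring

/-- The `[0, ∞]`-valued majorant of the kernel after integration in time frequency. -/
noncomputable def phaseMajorant (β τ ρ a R : ℝ) : ℝ≥0∞ :=
  4 * (∫⁻ x, bracketDecay β x) +
    ENNReal.ofReal ((a + R - ρ) ^ β) *
      (bracketConv β (τ - (a + R)) + bracketConv β (τ + (a + R))) +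
    ENNReal.ofReal ((ρ - |a - R|) ^ β) *
      (bracketConv β (τ - (a - R)) + bracketConv β (τ + (a - R)))

/-- Both signs of a − R occur in the majorant, so exchanging a and R only permutes its terms. -/
theorem phaseMajorant_comm (β τ ρ a R : ℝ) :
    phaseMajorant β τ ρ a R = phaseMajorant β τ ρ R a := by
  unfold phaseMajorant
  rw [add_comm R a, abs_sub_comm R a, add_comm (bracketConv β (τ - (R - a)))]
  congr 4 <;> ring_nf

theorem lintegral_time_le {τ a R ρ β A B : ℝ} (hβ : 0 ≤ β) (hA : 0 ≤ A) (hB : 0 ≤ B)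
    (hAB : 1 + β ≤ A + B) (h1 : ρ ≤ a + R) (h2 : |a - R| ≤ ρ) :
    ∫⁻ t, ENNReal.ofReal (bracket (|τ| - ρ) ^ β * ((bracket a ^ (-A) * bracket (|t| - a) ^ (-β)) *
        (bracket R ^ (-B) * bracket (|τ - t| - R) ^ (-β)))) ≤
      ENNReal.ofReal (3 ^ β) * ((bracketDecay (1 + β) a + bracketDecay (1 + β) R) *
        phaseMajorant β τ ρ a R) := by
  have hp : 0 ≤ a + R - ρ := by linarith
  have hm : 0 ≤ ρ - |a - R| := by linarith
  have pos (x s : ℝ) : 0 < bracket x ^ s := Real.rpow_pos_of_pos (bracket_pos x) _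
  have bound (t : ℝ) : ENNReal.ofReal (bracket (|τ| - ρ) ^ β *
        ((bracket a ^ (-A) * bracket (|t| - a) ^ (-β)) *
        (bracket R ^ (-B) * bracket (|τ - t| - R) ^ (-β)))) ≤
      ENNReal.ofReal (3 ^ β) * ((bracketDecay (1 + β) a + bracketDecay (1 + β) R) *
        (bracketDecay β (t - a) + bracketDecay β (t - -a) +
        (bracketDecay β (τ - t - R) + bracketDecay β (τ - t - -R)) +
        ENNReal.ofReal ((a + R - ρ) ^ β) * (bracketDecay β (t - a) * bracketDecay β (τ - t - R) +
          bracketDecay β (t - -a) * bracketDecay β (τ - t - -R)) +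
        ENNReal.ofReal ((ρ - |a - R|) ^ β) * (bracketDecay β (t - a) * bracketDecay β (τ - t - -R) +
          bracketDecay β (t - -a) * bracketDecay β (τ - t - R)))) := by
    have k1 := bracket_modulation_le (τ₁ := t) (τ₂ := τ - t) hβ h1 h2
    rw [add_sub_cancel] at k1
    have k2 := bracket_rpow_mul_bracket_rpow_le (x := a) (y := R) hA hB hAB
    have k3 := mul_le_mul k2 k1
      (mul_pos (pos _ _) (mul_pos (pos _ _) (pos _ _))).le (add_pos (pos _ _) (pos _ _)).le
    have q1 := pos a (-(1 + β))
    have q2 := pos R (-(1 + β))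
    have q3 := pos (t - a) (-β)
    have q4 := pos (t + a) (-β)
    have q5 := pos (τ - t - R) (-β)
    have q6 := pos (τ - t + R) (-β)
    simp only [bracketDecay, sub_neg_eq_add]
    -- With the powers abstracted to nonnegative reals, the claim becomes the real inequality `k3`.
    generalize bracket a ^ (-(1 + β)) = x1 at *
    generalize bracket R ^ (-(1 + β)) = x2 at *
    generalize bracket (t - a) ^ (-β) = x3 at *
    generalize bracket (t + a) ^ (-β) = x4 at *
    generalize bracket (τ - t - R) ^ (-β) = x5 at *
    generalize bracket (τ - t + R) ^ (-β) = x6 at *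
    have q7 : 0 ≤ (a + R - ρ) ^ β := by positivity
    have q8 : 0 ≤ (ρ - |a - R|) ^ β := by positivity
    generalize (a + R - ρ) ^ β = x7 at *
    generalize (ρ - |a - R|) ^ β = x8 at *
    simp (disch := positivity) only [← ENNReal.ofReal_add, ← ENNReal.ofReal_mul]
    apply ENNReal.ofReal_le_ofReal
    linarith
  refine (lintegral_mono bound).trans_eq ?_
  rw [lintegral_const_mul _ (by fun_prop), lintegral_const_mul _ (by fun_prop)]
  congr 2
  rw [lintegral_add_left (by fun_prop), lintegral_add_left (by fun_prop),
    lintegral_add_left (by fun_prop), lintegral_add_left (by fun_prop),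
    lintegral_add_left (by fun_prop), lintegral_const_mul _ (by fun_prop),
    lintegral_const_mul _ (by fun_prop), lintegral_add_left (by fun_prop),
    lintegral_add_left (by fun_prop)]
  simp only [lintegral_bracketDecay_mul_shift, lintegral_sub_right_eq_self (bracketDecay β)]
  have e (q : ℝ) : ∫⁻ t, bracketDecay β (τ - t - q) = ∫⁻ x, bracketDecay β x := by
    rw [lintegral_sub_left_eq_self (fun t => bracketDecay β (t - q)) τ,
      lintegral_sub_right_eq_self (bracketDecay β)]
  rw [e, e, phaseMajorant]
  congr 1
  · congr 1
    · ring
    · congr 3; ring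
  · congr 3; ring

/-! ### The uniform kernel bound. -/

/-- Only moduli enter, so ξ may be rotated to the positive real axis, where the polar formulas
apply. -/
theorem lintegral_norm_rotate (f : ℝ → ℝ → ℝ≥0∞) {ξ : ℂ} (hξ : ξ ≠ 0) :
    ∫⁻ η : ℂ, f ‖η‖ ‖ξ - η‖ = ∫⁻ η : ℂ, f ‖η‖ ‖((‖ξ‖ : ℝ) : ℂ) - η‖ := by
  have hn : ‖ξ‖ ≠ 0 := norm_ne_zero_iff.2 hξ
  let c : Circle := ⟨ξ / (‖ξ‖ : ℂ), by simp [Submonoid.unitSphere, hn]⟩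
  have hc : ξ = (c : ℂ) * (‖ξ‖ : ℂ) := by
    change ξ = ξ / (‖ξ‖ : ℂ) * (‖ξ‖ : ℂ)
    rw [div_mul_cancel₀]
    exact_mod_cast hn
  have hmp := (rotation c).measurePreserving
  have hme : MeasurableEmbedding (rotation c) :=
    (rotation c).toHomeomorph.measurableEmbedding
  rw [← hmp.lintegral_comp_emb hme]
  refine lintegral_congr fun η => ?_
  rw [LinearIsometryEquiv.norm_map]
  congr 1
  conv_lhs => rw [hc]
  rw [rotation_apply, ← mul_sub, norm_mul, Circle.norm_coe, one_mul]

/-- The constant in `lintegral_phaseMajorant_le`. -/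
noncomputable def phaseConst (β : ℝ) : ℝ≥0∞ :=
  (∫⁻ η : ℂ, bracketDecay (1 + β) ‖η‖) * (4 * ∫⁻ x, bracketDecay β x) +
    (ENNReal.ofReal (2 ^ β) * ENNReal.ofReal (2 * Real.pi)) *
      (2 * (∫⁻ x, bracketDecay β x) ^ 2) +
    (ENNReal.ofReal (3 * 2 ^ β) * ENNReal.ofReal (2 * Real.pi) +
      ENNReal.ofReal (1 / (β - 1)) * 6) * (2 * (∫⁻ x, bracketDecay β x) ^ 2)

theorem phaseConst_lt_top {β : ℝ} (hβ : 1 < β) : phaseConst β < ∞ := by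
  have h1 := lintegral_bracketDecay_lt_top hβ
  have h2 := lintegral_bracket_norm_rpow_lt_top (volume : Measure ℂ) (s := 1 + β)
    (by rw [Complex.finrank_real_complex]; push_cast; linarith)
  unfold phaseConst
  finiteness

theorem lintegral_phaseMajorant_le {β τ : ℝ} (hβ : 1 < β) {ξ : ℂ} (hξ : ξ ≠ 0) :
    ∫⁻ η : ℂ, bracketDecay (1 + β) ‖η‖ * phaseMajorant β τ ‖ξ‖ ‖η‖ ‖ξ - η‖ ≤ phaseConst β := by
  have hρ : 0 < ‖ξ‖ := norm_pos_iff.2 hξ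
  rw [lintegral_norm_rotate (fun a R => bracketDecay (1 + β) a * phaseMajorant β τ ‖ξ‖ a R) hξ]
  generalize ‖ξ‖ = ρ at *
  -- τ enters only through translation and reflection of this function, so its integral, and hence
  -- the bound, is independent of τ.
  have hg : Measurable fun y => bracketConv β (τ - y) + bracketConv β (τ + y) := by fun_prop
  have hgint : ∫⁻ y, (bracketConv β (τ - y) + bracketConv β (τ + y)) =
      2 * (∫⁻ x, bracketDecay β x) ^ 2 := by
    rw [lintegral_add_left (by fun_prop), lintegral_sub_left_eq_self (bracketConv β),
      lintegral_add_left_eq_self (bracketConv β), lintegral_bracketConv, two_mul]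
  have h1 := lintegral_elliptic_le hβ hρ hg
  have h2 := lintegral_hyperbolic_le hβ hρ hg
  rw [hgint] at h1 h2
  unfold phaseMajorant phaseConst
  simp_rw [mul_add (bracketDecay _ _), ← mul_assoc (bracketDecay _ _) (ENNReal.ofReal _)]
  have e (x s d : ℝ) : bracketDecay s x * ENNReal.ofReal d =
      ENNReal.ofReal (bracket x ^ (-s) * d) := by
    rw [bracketDecay, ENNReal.ofReal_mul (Real.rpow_nonneg (bracket_pos x).le _)]
  simp_rw [e]
  have hb := measurable_bracket
  rw [lintegral_add_left (by fun_prop), lintegral_add_left (by fun_prop),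
    lintegral_mul_const _ (by fun_prop)]
  exact add_le_add (add_le_add le_rfl h1) h2

/-- The kernel estimate. -/
theorem lintegral_kernel_le {β A B : ℝ} (hβ : 1 < β) (hA : 0 ≤ A) (hB : 0 ≤ B)
    (hAB : 1 + β ≤ A + B) (τ : ℝ) {ξ : ℂ} (hξ : ξ ≠ 0) :
    ∫⁻ η : ℂ, ∫⁻ t : ℝ, ENNReal.ofReal (bracket (|τ| - ‖ξ‖) ^ β *
        ((bracket ‖η‖ ^ (-A) * bracket (|t| - ‖η‖) ^ (-β)) *
        (bracket ‖ξ - η‖ ^ (-B) * bracket (|τ - t| - ‖ξ - η‖) ^ (-β)))) ≤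
      ENNReal.ofReal (3 ^ β) * (2 * phaseConst β) := by
  -- The reflection η ↦ ξ − η exchanges a and R, so decay in R costs no more than decay in a.
  have hsym : ∫⁻ η : ℂ, bracketDecay (1 + β) ‖ξ - η‖ * phaseMajorant β τ ‖ξ‖ ‖η‖ ‖ξ - η‖ =
      ∫⁻ η : ℂ, bracketDecay (1 + β) ‖η‖ * phaseMajorant β τ ‖ξ‖ ‖η‖ ‖ξ - η‖ := by
    rw [← lintegral_sub_left_eq_self _ ξ]
    refine lintegral_congr fun η => ?_
    rw [sub_sub_cancel, phaseMajorant_comm]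
  have hb := measurable_bracket
  calc _ ≤ ∫⁻ η : ℂ, ENNReal.ofReal (3 ^ β) *
        ((bracketDecay (1 + β) ‖η‖ + bracketDecay (1 + β) ‖ξ - η‖) *
          phaseMajorant β τ ‖ξ‖ ‖η‖ ‖ξ - η‖) := by
        refine lintegral_mono fun η => lintegral_time_le (by linarith) hA hB hAB ?_ ?_
        · simpa using norm_add_le η (ξ - η)
        · have h1 := norm_sub_le (ξ - η) ξ
          have h2 := norm_sub_le ξ η
          have h3 := norm_sub_le ξ (ξ - η)
          simp only [sub_sub_cancel_left, norm_neg, sub_sub_cancel] at h1 h3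
          exact abs_le.2 ⟨by linarith, by linarith⟩
    _ = ENNReal.ofReal (3 ^ β) * ∫⁻ η : ℂ,
        (bracketDecay (1 + β) ‖η‖ * phaseMajorant β τ ‖ξ‖ ‖η‖ ‖ξ - η‖ +
          bracketDecay (1 + β) ‖ξ - η‖ * phaseMajorant β τ ‖ξ‖ ‖η‖ ‖ξ - η‖) := by
        rw [lintegral_const_mul' _ _ ENNReal.ofReal_ne_top]
        simp_rw [add_mul]
    _ ≤ _ := by
        refine mul_le_mul' le_rfl ?_
        rw [lintegral_add_left (by unfold phaseMajorant; fun_prop), hsym, ← two_mul]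
        exact mul_le_mul' le_rfl (lintegral_phaseMajorant_le hβ hξ)

/-! ### Transfer of the kernel bound to space-time. -/

/-- The spatial part `ξ` of `ζ = (τ, ξ)`, as a complex number. -/
noncomputable def spatialPart (ζ : Spacetime) : ℂ := ⟨ζ 1, ζ 2⟩

theorem norm_spatialPart (ζ : Spacetime) : ‖spatialPart ζ‖ = spatialNorm ζ := by
  rw [Complex.norm_def, Complex.normSq_apply, spatialNorm, spatialPart, sq, sq]

theorem spatialPart_sub (ζ η : Spacetime) :
    spatialPart (ζ - η) = spatialPart ζ - spatialPart η := by
  apply Complex.ext <;> simp [spatialPart]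

theorem measurePreserving_time_spatialPart :
    MeasurePreserving fun ζ : Spacetime => (ζ 0, spatialPart ζ) := by
  have h1 := PiLp.volume_preserving_ofLp (Fin 3)
  have h2 := volume_preserving_piFinSuccAbove (fun _ : Fin 3 => ℝ) 0
  have h3 : MeasurePreserving (Prod.map (id : ℝ → ℝ) Complex.measurableEquivPi.symm) :=
    (MeasurePreserving.id volume).prod (Complex.volume_preserving_equiv_pi.symm)
  have e : (fun ζ : Spacetime => (ζ 0, spatialPart ζ)) =
      Prod.map (id : ℝ → ℝ) Complex.measurableEquivPi.symm ∘
        MeasurableEquiv.piFinSuccAbove (fun _ : Fin 3 => ℝ) 0 ∘ WithLp.ofLp := by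
    funext ζ
    refine Prod.ext rfl (Complex.ext ?_ ?_) <;>
      simp [spatialPart, Complex.measurableEquivPi_symm_apply] <;> rfl
  rw [e]
  exact h3.comp (h2.comp h1)

theorem lintegral_spacetime {F : ℝ × ℂ → ℝ≥0∞} (hF : Measurable F) :
    ∫⁻ ζ : Spacetime, F (ζ 0, spatialPart ζ) = ∫⁻ z : ℂ, ∫⁻ t : ℝ, F (t, z) := by
  rw [measurePreserving_time_spatialPart.lintegral_comp hF, Measure.volume_eq_prod,
    lintegral_prod_symm _ hF.aemeasurable]

/-- The kernel bound is proved for ξ ≠ 0 only; the excluded axis is negligible in the outer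
integral. -/
theorem ae_spatialPart_ne_zero : ∀ᵐ ζ : Spacetime, spatialPart ζ ≠ 0 := by
  have h : (volume : Measure (ℝ × ℂ)) (Set.univ ×ˢ {0}) = 0 := by
    rw [Measure.volume_eq_prod, Measure.prod_prod]; simp
  have h2 := measurePreserving_time_spatialPart.measure_preimage
    (s := Set.univ ×ˢ {0}) (MeasurableSet.univ.prod (measurableSet_singleton _)).nullMeasurableSet
  rw [h] at h2
  rw [ae_iff]
  convert h2 using 2
  ext ζ
  simp

theorem waveWeight_eq (s b : ℝ) (ζ : Spacetime) : waveWeight s b ζ =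
    bracket ‖spatialPart ζ‖ ^ s * bracket (|ζ 0| - ‖spatialPart ζ‖) ^ b := by
  rw [norm_spatialPart]; rfl

/-- The kernel of the bilinear operator `(ûW₁, v̂W₂) ↦ W (û * v̂)`. -/
noncomputable def waveKernel (α₁ α₂ b : ℝ) (ζ η : Spacetime) : ℝ≥0∞ :=
  ENNReal.ofReal (waveWeight 0 b ζ / (waveWeight α₁ b η * waveWeight α₂ b (ζ - η)))

theorem measurable_waveKernel (α₁ α₂ b : ℝ) :
    Measurable fun p : Spacetime × Spacetime => waveKernel α₁ α₂ b p.1 p.2 := by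
  have h (s : ℝ) : Measurable (waveWeight s b) := (continuous_waveWeight s b).measurable
  have h0 := h 0
  have h1 := h α₁
  have h2 := h α₂
  unfold waveKernel
  fun_prop

theorem waveKernel_rpow {r : ℝ} (hr : 0 ≤ r) (α₁ α₂ b : ℝ) (ζ η : Spacetime) :
    waveKernel α₁ α₂ b ζ η ^ r = ENNReal.ofReal (
      bracket (|ζ 0| - ‖spatialPart ζ‖) ^ (b * r) *
        ((bracket ‖spatialPart η‖ ^ (-(α₁ * r)) *
          bracket (|η 0| - ‖spatialPart η‖) ^ (-(b * r))) *
        (bracket ‖spatialPart ζ - spatialPart η‖ ^ (-(α₂ * r)) *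
          bracket (|ζ 0 - η 0| - ‖spatialPart ζ - spatialPart η‖) ^ (-(b * r))))) := by
  have hp (x s : ℝ) : 0 ≤ bracket x ^ s := Real.rpow_nonneg (bracket_pos x).le _
  have hW (s : ℝ) (ζ : Spacetime) := (waveWeight_pos s b ζ).le
  have e (x s : ℝ) : (bracket x ^ s) ^ r = bracket x ^ (s * r) :=
    (Real.rpow_mul (bracket_pos x).le _ _).symm
  have eW (s : ℝ) (ζ : Spacetime) : waveWeight s b ζ ^ r = waveWeight (s * r) (b * r) ζ := by
    rw [waveWeight_eq, waveWeight_eq, Real.mul_rpow (hp _ _) (hp _ _), e, e]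
  unfold waveKernel
  rw [ENNReal.ofReal_rpow_of_nonneg (div_nonneg (hW _ _) (mul_nonneg (hW _ _) (hW _ _))) hr,
    Real.div_rpow (hW _ _) (mul_nonneg (hW _ _) (hW _ _)), Real.mul_rpow (hW _ _) (hW _ _),
    eW, eW, eW]
  simp only [waveWeight_eq, spatialPart_sub, Real.rpow_neg (bracket_pos _).le]
  rw [zero_mul, Real.rpow_zero, one_mul, div_eq_mul_inv, mul_inv, mul_inv, mul_inv]
  rfl

/-- Multiplied by r, the hypotheses become β > 1 and 1 + β ≤ A + B for β = br, A = α₁r, B = α₂r. -/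
theorem lintegral_waveKernel_rpow_le {r b α₁ α₂ : ℝ} (hr : 1 < r) (hα₁ : 0 ≤ α₁) (hα₂ : 0 ≤ α₂)
    (hα : 1 / r + b ≤ α₁ + α₂) (hb : 1 / r < b) {ζ : Spacetime} (hζ : spatialPart ζ ≠ 0) :
    ∫⁻ η, waveKernel α₁ α₂ b ζ η ^ r ≤
      ENNReal.ofReal (3 ^ (b * r)) * (2 * phaseConst (b * r)) := by
  have hr0 : 0 < r := by linarith
  have hβ : 1 < b * r := (div_lt_iff₀ hr0).1 hb
  have hAB : 1 + b * r ≤ α₁ * r + α₂ * r := by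
    have := mul_le_mul_of_nonneg_right hα hr0.le
    rwa [add_mul, div_mul_cancel₀ _ hr0.ne', add_mul] at this
  simp_rw [waveKernel_rpow hr0.le]
  have hb' := measurable_bracket
  rw [lintegral_spacetime (F := fun p => ENNReal.ofReal (
      bracket (|ζ 0| - ‖spatialPart ζ‖) ^ (b * r) *
        ((bracket ‖p.2‖ ^ (-(α₁ * r)) * bracket (|p.1| - ‖p.2‖) ^ (-(b * r))) *
        (bracket ‖spatialPart ζ - p.2‖ ^ (-(α₂ * r)) *
          bracket (|ζ 0 - p.1| - ‖spatialPart ζ - p.2‖) ^ (-(b * r)))))) (by fun_prop)]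
  exact lintegral_kernel_le hβ (by positivity) (by positivity) hAB (ζ 0) hζ

/-! ### The convolution inequality and the product estimate for Schwartz functions. -/

/-- A Young-type inequality for convolutions with a kernel `K` satisfying a uniform bound. -/
theorem lintegral_convolution_kernel_rpow_le {E : Type*} [AddCommGroup E] [MeasurableSpace E]
    [MeasurableAdd₂ E] [MeasurableSub₂ E] [MeasurableNeg E] (μ : Measure E) [SFinite μ]
    [μ.IsAddRightInvariant] {p q : ℝ} (hpq : p.HolderConjugate q)
    {K : E → E → ℝ≥0∞} (hK : Measurable fun x : E × E => K x.1 x.2) {f g : E → ℝ≥0∞}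
    (hf : Measurable f) (hg : Measurable g) {C : ℝ≥0∞} (hC : ∀ᵐ x ∂μ, ∫⁻ y, K x y ^ p ∂μ ≤ C) :
    ∫⁻ x, (∫⁻ y, K x y * (f y * g (x - y)) ∂μ) ^ q ∂μ ≤
      (C ^ (1 / p)) ^ q * ((∫⁻ y, f y ^ q ∂μ) * ∫⁻ y, g y ^ q ∂μ) := by
  have hq : 0 < q := hpq.symm.pos
  have hp : 0 < p := hpq.pos
  have hm : Measurable fun x : E × E => f x.2 ^ q * g (x.1 - x.2) ^ q := by fun_prop
  calc _ ≤ ∫⁻ x, (C ^ (1 / p)) ^ q * ∫⁻ y, f y ^ q * g (x - y) ^ q ∂μ ∂μ := by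
        refine lintegral_mono_ae ?_
        filter_upwards [hC] with x hx
        have h := ENNReal.lintegral_mul_le_Lp_mul_Lq μ hpq
          (hK.comp measurable_prodMk_left : Measurable (K x)).aemeasurable
          (by fun_prop : AEMeasurable (fun y => f y * g (x - y)) μ)
        refine (ENNReal.rpow_le_rpow h hq.le).trans ?_
        rw [ENNReal.mul_rpow_of_nonneg _ _ hq.le, ← ENNReal.rpow_mul _ (1 / q) q,
          one_div_mul_cancel hq.ne', ENNReal.rpow_one]
        simp_rw [ENNReal.mul_rpow_of_nonneg _ _ hq.le]
        gcongr
        exact hx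
    _ = (C ^ (1 / p)) ^ q * ∫⁻ x, ∫⁻ y, f y ^ q * g (x - y) ^ q ∂μ ∂μ :=
        lintegral_const_mul _ hm.lintegral_prod_right'
    _ = _ := by
        rw [lintegral_lintegral_swap hm.aemeasurable]
        have e (y : E) : ∫⁻ x, f y ^ q * g (x - y) ^ q ∂μ = f y ^ q * ∫⁻ x, g x ^ q ∂μ := by
          rw [lintegral_const_mul _ (by fun_prop),
            lintegral_sub_right_eq_self (fun x => g x ^ q) y]
        simp_rw [e]
        rw [lintegral_mul_const _ (by fun_prop)]

/-- This is the convolution theorem applied to the inverse transforms, using that 𝓕⁻ is 𝓕 followed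
by reflection. -/
theorem fourier_schwartzMul (u v : 𝓢(Spacetime, ℂ)) (ζ : Spacetime) :
    𝓕 (schwartzMul u v) ζ = ∫ s, 𝓕 u s * 𝓕 v (ζ - s) := by
  have hinv (w : 𝓢(Spacetime, ℂ)) (x : Spacetime) : (𝓕⁻ w) x = (𝓕 w) (-x) := by
    rw [SchwartzMap.fourierInv_coe, SchwartzMap.fourier_coe, Real.fourierInv_eq_fourier_neg]
  have h1 : SchwartzMap.convolution (ContinuousLinearMap.mul ℂ ℂ) (𝓕⁻ u) (𝓕⁻ v) =
      𝓕⁻ (schwartzMul u v) := by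
    have h := SchwartzMap.fourier_convolution (ContinuousLinearMap.mul ℂ ℂ) (𝓕⁻ u) (𝓕⁻ v)
    rw [FourierTransform.fourier_fourierInv_eq, FourierTransform.fourier_fourierInv_eq] at h
    exact (FourierTransform.fourierInv_fourier_eq _).symm.trans
      (congrArg (fun w : 𝓢(Spacetime, ℂ) => 𝓕⁻ w) h)
  have h2 := SchwartzMap.convolution_apply (ContinuousLinearMap.mul ℂ ℂ) (𝓕⁻ u) (𝓕⁻ v) (-ζ)
  rw [h1, hinv, neg_neg] at h2
  rw [h2, convolution_def, ← integral_neg_eq_self]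
  refine integral_congr_ae (Filter.Eventually.of_forall fun s => ?_)
  simp only [ContinuousLinearMap.mul_apply', hinv, neg_neg]
  congr 2
  abel

theorem angularFourier_schwartzMul (u v : 𝓢(Spacetime, ℂ)) (ζ : Spacetime) :
    angularFourier (schwartzMul u v) ζ =
      ((2 * Real.pi)⁻¹ ^ 3 : ℝ) • ∫ s, angularFourier u s * angularFourier v (ζ - s) := by
  have h (w : 𝓢(Spacetime, ℂ)) (x : Spacetime) :
      angularFourier w x = 𝓕 w ((2 * Real.pi)⁻¹ • x) := rfl
  simp only [h, fourier_schwartzMul, smul_sub]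
  have h2 := Measure.integral_comp_smul (volume : Measure Spacetime)
    (fun s => 𝓕 u s * 𝓕 v ((2 * Real.pi)⁻¹ • ζ - s)) (2 * Real.pi)⁻¹
  have hpi : 0 < (2 * Real.pi)⁻¹ ^ 3 := pow_pos (inv_pos.2 Real.two_pi_pos) 3
  rw [h2, finrank_euclideanSpace_fin, smul_smul, abs_of_pos (inv_pos.2 hpi),
    mul_inv_cancel₀ hpi.ne', one_smul]

/-- The factor (2π)⁻³ from the angular normalization is at most 1 and is dropped. -/
theorem enorm_angularFourier_schwartzMul_le (u v : 𝓢(Spacetime, ℂ)) (ζ : Spacetime) :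
    ‖angularFourier (schwartzMul u v) ζ‖ₑ ≤
      ∫⁻ s, ‖angularFourier u s‖ₑ * ‖angularFourier v (ζ - s)‖ₑ := by
  have hpi : ‖((2 * Real.pi)⁻¹ ^ 3 : ℝ)‖ₑ ≤ 1 := by
    rw [enorm_pow]
    refine pow_le_one₀ zero_le ?_
    rw [Real.enorm_of_nonneg (inv_nonneg.2 Real.two_pi_pos.le), ENNReal.ofReal_le_one]
    exact inv_le_one_of_one_le₀ (by linarith [Real.pi_gt_three])
  rw [angularFourier_schwartzMul, enorm_smul]
  refine (mul_le_of_le_one_left zero_le hpi).trans ?_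
  refine (enorm_integral_le_lintegral_enorm _).trans_eq ?_
  simp only [enorm_mul]

theorem enorm_weightedFourier (s b : ℝ) (u : 𝓢(Spacetime, ℂ)) (ζ : Spacetime) :
    ‖weightedFourier s b u ζ‖ₑ = ENNReal.ofReal (waveWeight s b ζ) * ‖angularFourier u ζ‖ₑ := by
  rw [weightedFourier, enorm_mul, ← Real.enorm_of_nonneg (waveWeight_pos s b ζ).le]
  congr 1
  simp [enorm_eq_nnnorm]

theorem enorm_weightedFourier_schwartzMul_le (α₁ α₂ b : ℝ) (u v : 𝓢(Spacetime, ℂ))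
    (ζ : Spacetime) : ‖weightedFourier 0 b (schwartzMul u v) ζ‖ₑ ≤
      ∫⁻ η, waveKernel α₁ α₂ b ζ η *
        (‖weightedFourier α₁ b u η‖ₑ * ‖weightedFourier α₂ b v (ζ - η)‖ₑ) := by
  rw [enorm_weightedFourier]
  refine (mul_le_mul' le_rfl (enorm_angularFourier_schwartzMul_le u v ζ)).trans_eq ?_
  rw [← lintegral_const_mul' _ _ ENNReal.ofReal_ne_top]
  refine lintegral_congr fun η => ?_
  have h1 := waveWeight_pos α₁ b η
  have h2 := waveWeight_pos α₂ b (ζ - η)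
  have h0 := waveWeight_pos 0 b ζ
  rw [enorm_weightedFourier, enorm_weightedFourier, waveKernel, mul_mul_mul_comm,
    ← ENNReal.ofReal_mul h1.le, ← mul_assoc (ENNReal.ofReal (_ / _)),
    ← ENNReal.ofReal_mul (by positivity),
    div_mul_cancel₀ _ (by positivity)]

theorem continuous_weightedFourier (s b : ℝ) (u : 𝓢(Spacetime, ℂ)) :
    Continuous (weightedFourier s b u) :=
  (Complex.continuous_ofReal.comp (continuous_waveWeight s b)).mul (angularFourier u).continuous

/-- The constant in the product estimate. -/
noncomputable def productConst (r b : ℝ) : ℝ≥0∞ :=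
  (ENNReal.ofReal (3 ^ (b * r)) * (2 * phaseConst (b * r))) ^ (1 / r)

theorem eLpNorm_weightedFourier_schwartzMul_le {r b α₁ α₂ : ℝ} (hr : 1 < r) (hα₁ : 0 ≤ α₁)
    (hα₂ : 0 ≤ α₂) (hα : 1 / r + b ≤ α₁ + α₂) (hb : 1 / r < b) (u v : 𝓢(Spacetime, ℂ)) :
    eLpNorm (weightedFourier 0 b (schwartzMul u v)) (dualExp r) volume ≤
      productConst r b * (eLpNorm (weightedFourier α₁ b u) (dualExp r) volume *
        eLpNorm (weightedFourier α₂ b v) (dualExp r) volume) := by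
  have hpq : r.HolderConjugate (r / (r - 1)) := Real.HolderConjugate.conjExponent hr
  have hq : 0 < r / (r - 1) := hpq.symm.pos
  rw [dualExp_eq hr]
  generalize r / (r - 1) = q at *
  have e (f : Spacetime → ℂ) : eLpNorm f (ENNReal.ofReal q) volume =
      (∫⁻ x, ‖f x‖ₑ ^ q) ^ (1 / q) := by
    rw [eLpNorm_eq_lintegral_rpow_enorm_toReal (by simpa using hq) ENNReal.ofReal_ne_top,
      ENNReal.toReal_ofReal hq.le]
  have hm (s : ℝ) (w : 𝓢(Spacetime, ℂ)) : Measurable fun x => ‖weightedFourier s b w x‖ₑ :=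
    (continuous_weightedFourier s b w).measurable.enorm
  have key := lintegral_convolution_kernel_rpow_le volume hpq (measurable_waveKernel α₁ α₂ b)
    (hm α₁ u) (hm α₂ v) (ae_spatialPart_ne_zero.mono fun ζ hζ =>
      lintegral_waveKernel_rpow_le hr hα₁ hα₂ hα hb hζ)
  rw [e, e, e]
  have h1 : 0 ≤ 1 / q := by positivity
  calc _ ≤ ((productConst r b) ^ q * ((∫⁻ x, ‖weightedFourier α₁ b u x‖ₑ ^ q) *
        ∫⁻ x, ‖weightedFourier α₂ b v x‖ₑ ^ q)) ^ (1 / q) := by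
        refine ENNReal.rpow_le_rpow (le_trans (lintegral_mono fun ζ => ?_) key) h1
        exact ENNReal.rpow_le_rpow (enorm_weightedFourier_schwartzMul_le α₁ α₂ b u v ζ) hq.le
    _ = _ := by
        rw [ENNReal.mul_rpow_of_nonneg _ _ h1, ENNReal.mul_rpow_of_nonneg _ _ h1,
          ← ENNReal.rpow_mul, mul_one_div_cancel hq.ne', ENNReal.rpow_one]

theorem productConst_ne_top {r b : ℝ} (hr : 1 < r) (hb : 1 / r < b) : productConst r b ≠ ∞ := by
  have hr0 : 0 < r := by linarith
  have h := (phaseConst_lt_top ((div_lt_iff₀ hr0).1 hb)).ne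
  have h1 : 0 ≤ 1 / r := by positivity
  unfold productConst
  refine ENNReal.rpow_ne_top_of_nonneg h1 ?_
  finiteness

theorem waveNorm_schwartzMul_le {r b α₁ α₂ : ℝ} (hr : 1 < r) (hα₁ : 0 ≤ α₁)
    (hα₂ : 0 ≤ α₂) (hα : 1 / r + b ≤ α₁ + α₂) (hb : 1 / r < b) (u v : 𝓢(Spacetime, ℂ)) :
    waveNorm r 0 b (schwartzMul u v) ≤
      (productConst r b).toReal * waveNorm r α₁ b u * waveNorm r α₂ b v := by
  have h1 := (memLp_weightedFourier α₁ b u (dualExp r)).eLpNorm_ne_top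
  have h2 := (memLp_weightedFourier α₂ b v (dualExp r)).eLpNorm_ne_top
  have h3 := productConst_ne_top hr hb
  unfold waveNorm
  rw [mul_assoc, ← ENNReal.toReal_mul, ← ENNReal.toReal_mul]
  exact ENNReal.toReal_mono (ENNReal.mul_ne_top h3 (ENNReal.mul_ne_top h1 h2))
    (eLpNorm_weightedFourier_schwartzMul_le hr hα₁ hα₂ hα hb u v)

/-! ### Extension to the completions. -/

/-- A bounded bilinear map on normed spaces extends to their completions. -/
theorem exists_extension_completion₂ {𝕜 E F G : Type*} [NontriviallyNormedField 𝕜]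
    [NormedAddCommGroup E] [NormedSpace 𝕜 E] [NormedAddCommGroup F] [NormedSpace 𝕜 F]
    [NormedAddCommGroup G] [NormedSpace 𝕜 G] [CompleteSpace G]
    (f : E →ₗ[𝕜] F →ₗ[𝕜] G) {C : ℝ} (hC : ∀ x y, ‖f x y‖ ≤ C * ‖x‖ * ‖y‖) :
    ∃ B : Completion E →L[𝕜] Completion F →L[𝕜] G,
      (∀ (x : E) (y : F), B x y = f x y) ∧ ∀ x y, ‖B x y‖ ≤ C * ‖x‖ * ‖y‖ := by
  have denseE : DenseRange (Completion.toComplL : E →L[𝕜] Completion E) :=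
    Completion.denseRange_coe
  have denseF : DenseRange (Completion.toComplL : F →L[𝕜] Completion F) :=
    Completion.denseRange_coe
  let f₀ : E →L[𝕜] F →L[𝕜] G := f.mkContinuous₂ C hC
  let f₁ : Completion E →L[𝕜] F →L[𝕜] G := f₀.extend Completion.toComplL
  -- Flipping turns the second variable into the first, so the linear extension applies again.
  let f₂ : Completion F →L[𝕜] Completion E →L[𝕜] G := f₁.flip.extend Completion.toComplL
  have h (x : E) (y : F) : f₂.flip x y = f x y := by
    have e2 : f₂ (y : Completion F) = f₁.flip y :=
      ContinuousLinearMap.extend_eq f₁.flip denseF (Completion.isUniformInducing_coe F) y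
    have e1 : f₁ (x : Completion E) = f₀ x :=
      ContinuousLinearMap.extend_eq f₀ denseE (Completion.isUniformInducing_coe E) x
    rw [ContinuousLinearMap.flip_apply, e2, ContinuousLinearMap.flip_apply, e1]
    rfl
  refine ⟨f₂.flip, h, fun x y => ?_⟩
  refine Completion.induction_on₂ x y ?_ fun x y => ?_
  · exact isClosed_le (by fun_prop) (by fun_prop)
  · rw [h, Completion.norm_coe, Completion.norm_coe]
    exact hC x y

theorem schwartzMul_add_left (u₁ u₂ v : 𝓢(Spacetime, ℂ)) :
    schwartzMul (u₁ + u₂) v = schwartzMul u₁ v + schwartzMul u₂ v :=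
  SchwartzMap.ext fun z => add_mul (u₁ z) (u₂ z) (v z)

theorem schwartzMul_add_right (u v₁ v₂ : 𝓢(Spacetime, ℂ)) :
    schwartzMul u (v₁ + v₂) = schwartzMul u v₁ + schwartzMul u v₂ :=
  SchwartzMap.ext fun z => mul_add (u z) (v₁ z) (v₂ z)

theorem schwartzMul_smul_left (c : ℂ) (u v : 𝓢(Spacetime, ℂ)) :
    schwartzMul (c • u) v = c • schwartzMul u v :=
  SchwartzMap.ext fun z => smul_mul_assoc c (u z) (v z)

theorem schwartzMul_smul_right (c : ℂ) (u v : 𝓢(Spacetime, ℂ)) :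
    schwartzMul u (c • v) = c • schwartzMul u v :=
  SchwartzMap.ext fun z => mul_smul_comm c (u z) (v z)

theorem WaveSobolev.of_add (r s b : ℝ) (u v : 𝓢(Spacetime, ℂ)) :
    WaveSobolev.of r s b (u + v) = WaveSobolev.of r s b u + WaveSobolev.of r s b v :=
  Completion.coe_add (WaveSchwartz.of r s b u) (WaveSchwartz.of r s b v)

theorem WaveSobolev.of_smul (r s b : ℝ) (c : ℂ) (u : 𝓢(Spacetime, ℂ)) :
    WaveSobolev.of r s b (c • u) = c • WaveSobolev.of r s b u :=
  Completion.coe_smul c (WaveSchwartz.of r s b u)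

/-- The product of Schwartz functions as a bilinear map into `H^r_{0,b}`. -/
noncomputable def waveProduct (r α₁ α₂ b : ℝ) :
    WaveSchwartz r α₁ b →ₗ[ℂ] WaveSchwartz r α₂ b →ₗ[ℂ] WaveSobolev r 0 b :=
  LinearMap.mk₂ ℂ (fun u v => WaveSobolev.of r 0 b (schwartzMul u v))
    (fun u₁ u₂ v => (congrArg (WaveSobolev.of r 0 b) (schwartzMul_add_left u₁ u₂ v)).trans
      (WaveSobolev.of_add ..))
    (fun c u v => (congrArg (WaveSobolev.of r 0 b) (schwartzMul_smul_left c u v)).trans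
      (WaveSobolev.of_smul ..))
    (fun u v₁ v₂ => (congrArg (WaveSobolev.of r 0 b) (schwartzMul_add_right u v₁ v₂)).trans
      (WaveSobolev.of_add ..))
    (fun c u v => (congrArg (WaveSobolev.of r 0 b) (schwartzMul_smul_right c u v)).trans
      (WaveSobolev.of_smul ..))

theorem lemma3p5 (r b α₁ α₂ : ℝ) (hr : 1 < r) (hr2 : r ≤ 2) (hα₁ : 0 ≤ α₁) (hα₂ : 0 ≤ α₂)
    (hα : 1 / r + b ≤ α₁ + α₂) (hb : 1 / r < b) :
    ∃ C : ℝ, 0 < C ∧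
      (∀ u v : 𝓢(Spacetime, ℂ),
        waveNorm r 0 b (schwartzMul u v) ≤ C * waveNorm r α₁ b u * waveNorm r α₂ b v) ∧
      ∃ B : WaveSobolev r α₁ b →L[ℂ] WaveSobolev r α₂ b →L[ℂ] WaveSobolev r 0 b,
        (∀ u v : 𝓢(Spacetime, ℂ),
          B (WaveSobolev.of r α₁ b u) (WaveSobolev.of r α₂ b v) =
            WaveSobolev.of r 0 b (schwartzMul u v)) ∧
        ∀ (u : WaveSobolev r α₁ b) (v : WaveSobolev r α₂ b), ‖B u v‖ ≤ C * ‖u‖ * ‖v‖ := by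
  have hC := waveNorm_schwartzMul_le hr hα₁ hα₂ hα hb
  have hle : (productConst r b).toReal ≤ (productConst r b).toReal + 1 := by linarith
  have hmono (x y : ℝ) (hx : 0 ≤ x) (hy : 0 ≤ y) : (productConst r b).toReal * x * y ≤
      ((productConst r b).toReal + 1) * x * y := by gcongr
  have hS (u v : 𝓢(Spacetime, ℂ)) : ‖WaveSobolev.of r 0 b (schwartzMul u v)‖ ≤
      (productConst r b).toReal * ‖WaveSchwartz.of r α₁ b u‖ * ‖WaveSchwartz.of r α₂ b v‖ := by
    rw [WaveSobolev.norm_of, WaveSchwartz.norm_eq, WaveSchwartz.norm_eq]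
    exact hC u v
  obtain ⟨B, hB, hB'⟩ := exists_extension_completion₂ (waveProduct r α₁ α₂ b) fun u v => hS u v
  -- Adding 1 gives strict positivity without a lower bound on `productConst`.
  exact ⟨(productConst r b).toReal + 1, by positivity,
    fun u v => (hC u v).trans (hmono _ _ ENNReal.toReal_nonneg ENNReal.toReal_nonneg),
    B, fun u v => hB u v,
    fun u v => (hB' u v).trans (hmono _ _ (norm_nonneg _) (norm_nonneg _))⟩
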